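/- Let $H$ be a closed half-space of $\mathbb{R}^n$ and let $S$ be a unit sphere in $H$ that touches the bounding hyperplane of $H$. The one-sided kissing number $B(n)$ is the maximal number of pairwise nonoverlapping unit spheres in $H$ that touch $S$ (from outside). Let $N=(0,\dots,0,1)$ and let $S_+=\{x\in\mathbb{R}^n : |x|=1,\ x_n\ge 0\}$ be the closed upper unit hemisphere. A one-sided kissing arrangement is a set $P\subset S_+$ any two distinct points of which have angular distance at least $60^\circ$. Let $a(P)$ be the number of points $p\in P$ with $60^\circ\le \operatorname{dist}(p,N)\le 90^\circ$ and $b(P)$ the number of those with $\operatorname{dist}(p,N)<60^\circ$, where $\operatorname{dist}$ is the angular distance. Then $$B(3)=9.$$ Equivalently, the maximal size of a one-sided kissing arrangement in $\mathbb{R}^3$ is $9$. Moreover, every one-sided kissing arrangement $P\subset\mathbb{R}^3$ with $|P|=B(3)$ satisfies $a(P)=6$ and $b(P)=3$. -/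

import Mathlib

open scoped RealInnerProductSpace

/-! ### The one-sided kissing number through touching spheres

Spheres of radius one are described by their centres. -/

/-- The closed half-space `{x | c ≤ ⟪ν, x⟫}` of `ℝⁿ` (used with `‖ν‖ = 1`). -/
def closedHalfSpace {n : ℕ} (ν : EuclideanSpace ℝ (Fin n)) (c : ℝ) :
    Set (EuclideanSpace ℝ (Fin n)) :=
  {x | c ≤ ⟪ν, x⟫}

/-- The supporting hyperplane `{x | ⟪ν, x⟫ = c}` of that half-space. -/
def boundingHyperplane {n : ℕ} (ν : EuclideanSpace ℝ (Fin n)) (c : ℝ) :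
    Set (EuclideanSpace ℝ (Fin n)) :=
  {x | ⟪ν, x⟫ = c}

/-- The unit spheres centred at `x` and `y` do not overlap: the open balls they bound are
disjoint. -/
def Nonoverlapping {n : ℕ} (x y : EuclideanSpace ℝ (Fin n)) : Prop :=
  Disjoint (Metric.ball x 1) (Metric.ball y 1)

/-- The unit sphere `S` centred at `z` lies in the half-space `H` given by `ν` and `c` and touches
its bounding hyperplane, and `C` is the set of centres of pairwise nonoverlapping unit spheres
in `H`, each of which touches `S` from outside. -/
structure IsOneSidedKissingConfiguration {n : ℕ} (ν : EuclideanSpace ℝ (Fin n)) (c : ℝ)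
    (z : EuclideanSpace ℝ (Fin n)) (C : Set (EuclideanSpace ℝ (Fin n))) : Prop where
  norm_normal : ‖ν‖ = 1
  central_subset : Metric.sphere z 1 ⊆ closedHalfSpace ν c
  central_touches : (Metric.sphere z 1 ∩ boundingHyperplane ν c).Nonempty
  subset : ∀ x ∈ C, Metric.sphere x 1 ⊆ closedHalfSpace ν c
  touches : ∀ x ∈ C, Nonoverlapping x z ∧ (Metric.sphere x 1 ∩ Metric.sphere z 1).Nonempty
  pairwise_nonoverlapping : C.Pairwise Nonoverlapping

/-- The one-sided kissing number `B(n)`: the largest number of nonoverlapping unit spheres in a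
closed half-space `H` of `ℝⁿ` that touch a unit sphere in `H` which touches the bounding
hyperplane of `H`. (A supremum in `ℕ∞`, hence attained as soon as it is finite.) -/
noncomputable def oneSidedKissingNumber (n : ℕ) : ℕ∞ :=
  ⨆ (ν : EuclideanSpace ℝ (Fin n)) (c : ℝ) (z : EuclideanSpace ℝ (Fin n))
    (C : Set (EuclideanSpace ℝ (Fin n))) (_ : IsOneSidedKissingConfiguration ν c z C), C.encard

/-! ### One-sided kissing arrangements on the closed hemisphere -/

/-- The north pole `N = (0, …, 0, 1)`; `⊤ : Fin n` is the last index. -/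
noncomputable def northPole (n : ℕ) [NeZero n] : EuclideanSpace ℝ (Fin n) :=
  EuclideanSpace.single ⊤ 1

/-- The closed upper hemisphere `S₊` of the unit sphere, where the last coordinate is
nonnegative. -/
def upperHemisphere (n : ℕ) [NeZero n] : Set (EuclideanSpace ℝ (Fin n)) :=
  {p | p ∈ Metric.sphere 0 1 ∧ 0 ≤ p ⊤}

/-- `P` is a kissing arrangement in the subset `Δ` of the unit sphere: `P ⊆ Δ` and the angular
separation of any two distinct points of `P` is at least `60°`. -/
def IsKissingArrangementIn {n : ℕ} (Δ P : Set (EuclideanSpace ℝ (Fin n))) : Prop :=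
  P ⊆ Δ ∧ P.Pairwise fun p q => Real.pi / 3 ≤ InnerProductGeometry.angle p q

/-- `P` is a one-sided kissing arrangement: a kissing arrangement in `S₊`. -/
def IsOneSidedKissingArrangement {n : ℕ} [NeZero n] (P : Set (EuclideanSpace ℝ (Fin n))) : Prop :=
  IsKissingArrangementIn (upperHemisphere n) P

/-- The largest size of a one-sided kissing arrangement, `A(n, 60°, 90°)`. -/
noncomputable def oneSidedCodeNumber (n : ℕ) [NeZero n] : ℕ∞ :=
  ⨆ (P : Set (EuclideanSpace ℝ (Fin n))) (_ : IsOneSidedKissingArrangement P), P.encard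

/-- `P_a`, the points of `P` at angular distance between `60°` and `90°` from the north pole. -/
def lowPart {n : ℕ} [NeZero n] (P : Set (EuclideanSpace ℝ (Fin n))) :
    Set (EuclideanSpace ℝ (Fin n)) :=
  {p ∈ P | Real.pi / 3 ≤ InnerProductGeometry.angle p (northPole n) ∧
    InnerProductGeometry.angle p (northPole n) ≤ Real.pi / 2}

/-- `P_b`, the points of `P` at angular distance less than `60°` from the north pole. -/
def highPart {n : ℕ} [NeZero n] (P : Set (EuclideanSpace ℝ (Fin n))) :
    Set (EuclideanSpace ℝ (Fin n)) :=
  {p ∈ P | InnerProductGeometry.angle p (northPole n) < Real.pi / 3}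

/-! Let `P` have `a` points of height at most 1/2 and `b` points above it. Mirroring the `b` high
points in the equatorial plane keeps all angles at least 60°: a high point is more than 60° from its
own image, and reflecting one of two points of the hemisphere only moves them apart. The result is a
kissing configuration of `a + 2b` points, so `a + 2b ≤ 12` by the kissing number of space
(`card_le_twelve`). The low points, projected to the equator, have pairwise azimuth differences of
at least arccos(1/√3), which exceeds 2π/7, so `a ≤ 6` (`card_le_six_of_low`). Adding the two
inequalities gives `a + b ≤ 9`, and equality forces `a = 6`, `b = 3`. A regular hexagon on the
equator with three points above it attains 9.

The bound 12 is Delsarte's method with a correction for nearly antipodal points. The polynomial `f`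
= `kissingPolynomial` has nonnegative Legendre coefficients and constant term 1, so its sum over all
ordered pairs of `n` points is at least `n²`. It is nonpositive on [-0.70711, 1/2], so the sum over
the row of a point x comes from x itself and from the points within about 45° of -x. There are at
most three of these, and they contribute less than 13 - f(1) (`sum_kissingPolynomial_lt`). Hence `n²
< 13n`. -/

open scoped ComplexConjugate

/-! ### Positive definite kernels on the sphere -/

/-- The entries of a real square matrix have nonnegative sum. -/
def IsPosSum {ι : Type*} [Fintype ι] (K : ι → ι → ℝ) : Prop :=
  0 ≤ ∑ i, ∑ j, K i j

theorem IsPosSum.add {ι : Type*} [Fintype ι] {K K' : ι → ι → ℝ} (h : IsPosSum K)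
    (h' : IsPosSum K') : IsPosSum fun i j => K i j + K' i j := by
  unfold IsPosSum at *
  simp only [Finset.sum_add_distrib]
  exact add_nonneg h h'

theorem IsPosSum.const_mul {ι : Type*} [Fintype ι] {K : ι → ι → ℝ} (h : IsPosSum K) {c : ℝ}
    (hc : 0 ≤ c) : IsPosSum fun i j => c * K i j := by
  unfold IsPosSum at *
  simp only [← Finset.mul_sum]
  exact mul_nonneg hc h

/-- The real part of the `m`-th power of `z * conj w`. -/
noncomputable def azimuthal (m : ℕ) (z w : ℂ) : ℝ :=
  (z ^ m * conj w ^ m).re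

theorem azimuthal_zero (z w : ℂ) : azimuthal 0 z w = 1 := by
  simp [azimuthal]

theorem azimuthal_one (z w : ℂ) : azimuthal 1 z w = (z * conj w).re := by
  simp [azimuthal]

/-- Chebyshev's recurrence in homogeneous form. It makes every `azimuthal m` a polynomial in Re(z *
conj w) and the two squared norms, which reduces the addition formulas below to `ring`. -/
theorem azimuthal_add_two (m : ℕ) (z w : ℂ) :
    azimuthal (m + 2) z w = 2 * (z * conj w).re * azimuthal (m + 1) z w -
      Complex.normSq z * Complex.normSq w * azimuthal m z w := by
  have key : ∀ q : ℂ, (q ^ (m + 2)).re =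
      2 * q.re * (q ^ (m + 1)).re - Complex.normSq q * (q ^ m).re := by
    intro q
    simp only [pow_succ, Complex.mul_re, Complex.mul_im, Complex.normSq_apply]
    ring
  have h := key (z * conj w)
  simpa only [azimuthal, mul_pow, Complex.normSq_mul, Complex.normSq_conj] using h

/-- The double sum is the squared modulus of ∑ aᵢ zᵢ^m. -/
theorem isPosSum_azimuthal {ι : Type*} [Fintype ι] (a : ι → ℝ) (z : ι → ℂ) (m : ℕ) :
    IsPosSum fun i j => a i * a j * azimuthal m (z i) (z j) := by
  have h : ∑ i, ∑ j, a i * a j * azimuthal m (z i) (z j) =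
      Complex.normSq (∑ i, a i * z i ^ m) := by
    have h1 : ((∑ i, (a i : ℂ) * z i ^ m) * conj (∑ i, (a i : ℂ) * z i ^ m)).re =
        Complex.normSq (∑ i, a i * z i ^ m) := by
      rw [Complex.mul_conj, Complex.ofReal_re]
    rw [← h1, map_sum, Finset.sum_mul_sum, Complex.re_sum]
    refine Finset.sum_congr rfl fun i _ => ?_
    rw [Complex.re_sum]
    refine Finset.sum_congr rfl fun j _ => ?_
    have h2 : (a i : ℂ) * z i ^ m * conj ((a j : ℂ) * z j ^ m) =
        ((a i * a j : ℝ) : ℂ) * (z i ^ m * conj (z j) ^ m) := by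
      simp only [map_mul, map_pow, Complex.conj_ofReal, Complex.ofReal_mul]
      ring
    rw [h2, Complex.re_ofReal_mul, azimuthal]
  unfold IsPosSum
  rw [h]
  exact Complex.normSq_nonneg _

theorem isPosSum_inner {ι : Type*} [Fintype ι] (u : ι → ℝ) (z : ι → ℂ) :
    IsPosSum fun i j => u i * u j + (z i * conj (z j)).re := by
  simpa [azimuthal_zero, azimuthal_one] using
    (isPosSum_azimuthal u z 0).add (isPosSum_azimuthal (fun _ => 1) z 1)

/-- The Legendre polynomial of degree two. -/
noncomputable def legendreTwo (t : ℝ) : ℝ :=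
  (3 * t ^ 2 - 1) / 2

/-- The addition theorem for spherical harmonics, for unit vectors (z, u) and (w, v) of ℂ × ℝ. The
factors in `u` and `v` are proportional to the derivatives of the Legendre polynomial; the usual
powers of sin θ are absorbed in `azimuthal`, as `z` and `w` are not normalized. All coefficients are
nonnegative, so positivity follows term by term. The higher degrees follow the same pattern. -/
theorem legendreTwo_addition {u v : ℝ} {z w : ℂ} (hz : Complex.normSq z = 1 - u ^ 2)
    (hw : Complex.normSq w = 1 - v ^ 2) :
    legendreTwo (u * v + (z * conj w).re) =
      1 / 4 * ((3 * u ^ 2 - 1) * (3 * v ^ 2 - 1) * azimuthal 0 z w) +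
      3 * ((u) * (v) * azimuthal 1 z w) +
      3 / 4 * ((1) * (1) * azimuthal 2 z w) := by
  simp only [azimuthal_zero, azimuthal_one, azimuthal_add_two, zero_add, hz, hw, legendreTwo]
  ring

theorem isPosSum_legendreTwo {ι : Type*} [Fintype ι] {u : ι → ℝ} {z : ι → ℂ}
    (hz : ∀ i, Complex.normSq (z i) = 1 - u i ^ 2) :
    IsPosSum fun i j => legendreTwo (u i * u j + (z i * conj (z j)).re) := by
  simp_rw [legendreTwo_addition (hz _) (hz _)]
  exact (((isPosSum_azimuthal (fun i => 3 * u i ^ 2 - 1) z 0).const_mul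
      (by norm_num : (0 : ℝ) ≤ 1 / 4)).add
    ((isPosSum_azimuthal (fun i => u i) z 1).const_mul
      (by norm_num : (0 : ℝ) ≤ 3))).add
    ((isPosSum_azimuthal (fun i => 1) z 2).const_mul
      (by norm_num : (0 : ℝ) ≤ 3 / 4))

/-- The Legendre polynomial of degree three. -/
noncomputable def legendreThree (t : ℝ) : ℝ :=
  (5 * t ^ 3 - 3 * t) / 2

theorem legendreThree_addition {u v : ℝ} {z w : ℂ} (hz : Complex.normSq z = 1 - u ^ 2)
    (hw : Complex.normSq w = 1 - v ^ 2) :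
    legendreThree (u * v + (z * conj w).re) =
      1 / 4 * ((5 * u ^ 3 - 3 * u) * (5 * v ^ 3 - 3 * v) * azimuthal 0 z w) +
      3 / 8 * ((5 * u ^ 2 - 1) * (5 * v ^ 2 - 1) * azimuthal 1 z w) +
      15 / 4 * ((u) * (v) * azimuthal 2 z w) +
      5 / 8 * ((1) * (1) * azimuthal 3 z w) := by
  simp only [azimuthal_zero, azimuthal_one, azimuthal_add_two, zero_add, Nat.reduceAdd,
    hz, hw, legendreThree]
  ring

theorem isPosSum_legendreThree {ι : Type*} [Fintype ι] {u : ι → ℝ} {z : ι → ℂ}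
    (hz : ∀ i, Complex.normSq (z i) = 1 - u i ^ 2) :
    IsPosSum fun i j => legendreThree (u i * u j + (z i * conj (z j)).re) := by
  simp_rw [legendreThree_addition (hz _) (hz _)]
  exact ((((isPosSum_azimuthal (fun i => 5 * u i ^ 3 - 3 * u i) z 0).const_mul
      (by norm_num : (0 : ℝ) ≤ 1 / 4)).add
    ((isPosSum_azimuthal (fun i => 5 * u i ^ 2 - 1) z 1).const_mul
      (by norm_num : (0 : ℝ) ≤ 3 / 8))).add
    ((isPosSum_azimuthal (fun i => u i) z 2).const_mul
      (by norm_num : (0 : ℝ) ≤ 15 / 4))).add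
    ((isPosSum_azimuthal (fun i => 1) z 3).const_mul
      (by norm_num : (0 : ℝ) ≤ 5 / 8))

/-- The Legendre polynomial of degree four. -/
noncomputable def legendreFour (t : ℝ) : ℝ :=
  (35 * t ^ 4 - 30 * t ^ 2 + 3) / 8

theorem legendreFour_addition {u v : ℝ} {z w : ℂ} (hz : Complex.normSq z = 1 - u ^ 2)
    (hw : Complex.normSq w = 1 - v ^ 2) :
    legendreFour (u * v + (z * conj w).re) =
      1 / 64 * ((35 * u ^ 4 - 30 * u ^ 2 + 3) * (35 * v ^ 4 - 30 * v ^ 2 + 3) * azimuthal 0 z w) +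
      5 / 8 * ((7 * u ^ 3 - 3 * u) * (7 * v ^ 3 - 3 * v) * azimuthal 1 z w) +
      5 / 16 * ((7 * u ^ 2 - 1) * (7 * v ^ 2 - 1) * azimuthal 2 z w) +
      35 / 8 * ((u) * (v) * azimuthal 3 z w) +
      35 / 64 * ((1) * (1) * azimuthal 4 z w) := by
  simp only [azimuthal_zero, azimuthal_one, azimuthal_add_two, zero_add, Nat.reduceAdd,
    hz, hw, legendreFour]
  ring

theorem isPosSum_legendreFour {ι : Type*} [Fintype ι] {u : ι → ℝ} {z : ι → ℂ}
    (hz : ∀ i, Complex.normSq (z i) = 1 - u i ^ 2) :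
    IsPosSum fun i j => legendreFour (u i * u j + (z i * conj (z j)).re) := by
  simp_rw [legendreFour_addition (hz _) (hz _)]
  exact (((((isPosSum_azimuthal (fun i => 35 * u i ^ 4 - 30 * u i ^ 2 + 3) z 0).const_mul
      (by norm_num : (0 : ℝ) ≤ 1 / 64)).add
    ((isPosSum_azimuthal (fun i => 7 * u i ^ 3 - 3 * u i) z 1).const_mul
      (by norm_num : (0 : ℝ) ≤ 5 / 8))).add
    ((isPosSum_azimuthal (fun i => 7 * u i ^ 2 - 1) z 2).const_mul
      (by norm_num : (0 : ℝ) ≤ 5 / 16))).add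
    ((isPosSum_azimuthal (fun i => u i) z 3).const_mul
      (by norm_num : (0 : ℝ) ≤ 35 / 8))).add
    ((isPosSum_azimuthal (fun i => 1) z 4).const_mul
      (by norm_num : (0 : ℝ) ≤ 35 / 64))

/-- The Legendre polynomial of degree five. -/
noncomputable def legendreFive (t : ℝ) : ℝ :=
  (63 * t ^ 5 - 70 * t ^ 3 + 15 * t) / 8

theorem legendreFive_addition {u v : ℝ} {z w : ℂ} (hz : Complex.normSq z = 1 - u ^ 2)
    (hw : Complex.normSq w = 1 - v ^ 2) :
    legendreFive (u * v + (z * conj w).re) =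
      1 / 64 * ((63 * u ^ 5 - 70 * u ^ 3 + 15 * u) * (63 * v ^ 5 - 70 * v ^ 3 + 15 * v) * azimuthal 0 z w) +
      15 / 64 * ((21 * u ^ 4 - 14 * u ^ 2 + 1) * (21 * v ^ 4 - 14 * v ^ 2 + 1) * azimuthal 1 z w) +
      105 / 16 * ((3 * u ^ 3 - u) * (3 * v ^ 3 - v) * azimuthal 2 z w) +
      35 / 128 * ((9 * u ^ 2 - 1) * (9 * v ^ 2 - 1) * azimuthal 3 z w) +
      315 / 64 * ((u) * (v) * azimuthal 4 z w) +
      63 / 128 * ((1) * (1) * azimuthal 5 z w) := by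
  simp only [azimuthal_zero, azimuthal_one, azimuthal_add_two, zero_add, Nat.reduceAdd,
    hz, hw, legendreFive]
  ring

theorem isPosSum_legendreFive {ι : Type*} [Fintype ι] {u : ι → ℝ} {z : ι → ℂ}
    (hz : ∀ i, Complex.normSq (z i) = 1 - u i ^ 2) :
    IsPosSum fun i j => legendreFive (u i * u j + (z i * conj (z j)).re) := by
  simp_rw [legendreFive_addition (hz _) (hz _)]
  exact ((((((isPosSum_azimuthal (fun i => 63 * u i ^ 5 - 70 * u i ^ 3 + 15 * u i) z 0).const_mul
      (by norm_num : (0 : ℝ) ≤ 1 / 64)).add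
    ((isPosSum_azimuthal (fun i => 21 * u i ^ 4 - 14 * u i ^ 2 + 1) z 1).const_mul
      (by norm_num : (0 : ℝ) ≤ 15 / 64))).add
    ((isPosSum_azimuthal (fun i => 3 * u i ^ 3 - u i) z 2).const_mul
      (by norm_num : (0 : ℝ) ≤ 105 / 16))).add
    ((isPosSum_azimuthal (fun i => 9 * u i ^ 2 - 1) z 3).const_mul
      (by norm_num : (0 : ℝ) ≤ 35 / 128))).add
    ((isPosSum_azimuthal (fun i => u i) z 4).const_mul
      (by norm_num : (0 : ℝ) ≤ 315 / 64))).add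
    ((isPosSum_azimuthal (fun i => 1) z 5).const_mul
      (by norm_num : (0 : ℝ) ≤ 63 / 128))

/-- The Legendre polynomial of degree nine. -/
noncomputable def legendreNine (t : ℝ) : ℝ :=
  (12155 * t ^ 9 - 25740 * t ^ 7 + 18018 * t ^ 5 - 4620 * t ^ 3 + 315 * t) / 128

theorem legendreNine_addition {u v : ℝ} {z w : ℂ} (hz : Complex.normSq z = 1 - u ^ 2)
    (hw : Complex.normSq w = 1 - v ^ 2) :
    legendreNine (u * v + (z * conj w).re) =
      1 / 16384 * ((12155 * u ^ 9 - 25740 * u ^ 7 + 18018 * u ^ 5 - 4620 * u ^ 3 + 315 * u) * (12155 * v ^ 9 - 25740 * v ^ 7 + 18018 * v ^ 5 - 4620 * v ^ 3 + 315 * v) * azimuthal 0 z w) +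
      45 / 16384 * ((2431 * u ^ 8 - 4004 * u ^ 6 + 2002 * u ^ 4 - 308 * u ^ 2 + 7) * (2431 * v ^ 8 - 4004 * v ^ 6 + 2002 * v ^ 4 - 308 * v ^ 2 + 7) * azimuthal 1 z w) +
      495 / 2048 * ((221 * u ^ 7 - 273 * u ^ 5 + 91 * u ^ 3 - 7 * u) * (221 * v ^ 7 - 273 * v ^ 5 + 91 * v ^ 3 - 7 * v) * azimuthal 2 z w) +
      1155 / 8192 * ((221 * u ^ 6 - 195 * u ^ 4 + 39 * u ^ 2 - 1) * (221 * v ^ 6 - 195 * v ^ 4 + 39 * v ^ 2 - 1) * azimuthal 3 z w) +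
      45045 / 4096 * ((17 * u ^ 5 - 10 * u ^ 3 + u) * (17 * v ^ 5 - 10 * v ^ 3 + v) * azimuthal 4 z w) +
      1287 / 8192 * ((85 * u ^ 4 - 30 * u ^ 2 + 1) * (85 * v ^ 4 - 30 * v ^ 2 + 1) * azimuthal 5 z w) +
      2145 / 2048 * ((17 * u ^ 3 - 3 * u) * (17 * v ^ 3 - 3 * v) * azimuthal 6 z w) +
      6435 / 32768 * ((17 * u ^ 2 - 1) * (17 * v ^ 2 - 1) * azimuthal 7 z w) +
      109395 / 16384 * ((u) * (v) * azimuthal 8 z w) +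
      12155 / 32768 * ((1) * (1) * azimuthal 9 z w) := by
  simp only [azimuthal_zero, azimuthal_one, azimuthal_add_two, zero_add, Nat.reduceAdd,
    hz, hw, legendreNine]
  ring

theorem isPosSum_legendreNine {ι : Type*} [Fintype ι] {u : ι → ℝ} {z : ι → ℂ}
    (hz : ∀ i, Complex.normSq (z i) = 1 - u i ^ 2) :
    IsPosSum fun i j => legendreNine (u i * u j + (z i * conj (z j)).re) := by
  simp_rw [legendreNine_addition (hz _) (hz _)]
  exact ((((((((((isPosSum_azimuthal (fun i => 12155 * u i ^ 9 - 25740 * u i ^ 7 + 18018 * u i ^ 5 - 4620 * u i ^ 3 + 315 * u i) z 0).const_mul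
      (by norm_num : (0 : ℝ) ≤ 1 / 16384)).add
    ((isPosSum_azimuthal (fun i => 2431 * u i ^ 8 - 4004 * u i ^ 6 + 2002 * u i ^ 4 - 308 * u i ^ 2 + 7) z 1).const_mul
      (by norm_num : (0 : ℝ) ≤ 45 / 16384))).add
    ((isPosSum_azimuthal (fun i => 221 * u i ^ 7 - 273 * u i ^ 5 + 91 * u i ^ 3 - 7 * u i) z 2).const_mul
      (by norm_num : (0 : ℝ) ≤ 495 / 2048))).add
    ((isPosSum_azimuthal (fun i => 221 * u i ^ 6 - 195 * u i ^ 4 + 39 * u i ^ 2 - 1) z 3).const_mul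
      (by norm_num : (0 : ℝ) ≤ 1155 / 8192))).add
    ((isPosSum_azimuthal (fun i => 17 * u i ^ 5 - 10 * u i ^ 3 + u i) z 4).const_mul
      (by norm_num : (0 : ℝ) ≤ 45045 / 4096))).add
    ((isPosSum_azimuthal (fun i => 85 * u i ^ 4 - 30 * u i ^ 2 + 1) z 5).const_mul
      (by norm_num : (0 : ℝ) ≤ 1287 / 8192))).add
    ((isPosSum_azimuthal (fun i => 17 * u i ^ 3 - 3 * u i) z 6).const_mul
      (by norm_num : (0 : ℝ) ≤ 2145 / 2048))).add
    ((isPosSum_azimuthal (fun i => 17 * u i ^ 2 - 1) z 7).const_mul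
      (by norm_num : (0 : ℝ) ≤ 6435 / 32768))).add
    ((isPosSum_azimuthal (fun i => u i) z 8).const_mul
      (by norm_num : (0 : ℝ) ≤ 109395 / 16384))).add
    ((isPosSum_azimuthal (fun i => 1) z 9).const_mul
      (by norm_num : (0 : ℝ) ≤ 12155 / 32768))

/-! ### Estimates of the kissing polynomial -/

/-- For `i + j = 9` these are, up to constants, the Bernstein basis of degree 9 on [a, b]. A
polynomial inequality whose Bernstein coefficients have the right sign is then linear in these
facts; the breakpoints in the proofs below split the range until this holds on every piece. -/
theorem sub_pow_mul_sub_pow_nonneg {a b t : ℝ} (ha : a ≤ t) (hb : t ≤ b) (i j : ℕ) :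
    0 ≤ (t - a) ^ i * (b - t) ^ j :=
  mul_nonneg (pow_nonneg (sub_nonneg.2 ha) i) (pow_nonneg (sub_nonneg.2 hb) j)

/-- The function whose sum over pairs of points of a kissing configuration is estimated. -/
noncomputable def kissingPolynomial (t : ℝ) : ℝ :=
  1 + 191 / 100 * t + 7 / 2 * legendreTwo t + 39 / 20 * legendreThree t +
    199 / 100 * legendreFour t + 3 / 25 * legendreFive t + 19 / 50 * legendreNine t

theorem kissingPolynomial_one : kissingPolynomial 1 = 217 / 20 := by
  norm_num [kissingPolynomial, legendreTwo, legendreThree, legendreFour, legendreFive,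
    legendreNine]

theorem kissingPolynomial_nonpos {t : ℝ} (h₁ : -70711 / 100000 ≤ t) (h₂ : t ≤ 1 / 2) :
    kissingPolynomial t ≤ 0 := by
  simp only [kissingPolynomial, legendreTwo, legendreThree, legendreFour, legendreFive, legendreNine]
  rcases le_total t (-421 / 1000) with h | h
  · linarith [sub_pow_mul_sub_pow_nonneg h₁ h 0 9, sub_pow_mul_sub_pow_nonneg h₁ h 1 8,
        sub_pow_mul_sub_pow_nonneg h₁ h 2 7, sub_pow_mul_sub_pow_nonneg h₁ h 3 6,
        sub_pow_mul_sub_pow_nonneg h₁ h 4 5, sub_pow_mul_sub_pow_nonneg h₁ h 5 4,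
        sub_pow_mul_sub_pow_nonneg h₁ h 6 3, sub_pow_mul_sub_pow_nonneg h₁ h 7 2,
        sub_pow_mul_sub_pow_nonneg h₁ h 8 1, sub_pow_mul_sub_pow_nonneg h₁ h 9 0]
  clear h₁
  rename' h => h₁
  rcases le_total t (-101 / 500) with h | h
  · linarith [sub_pow_mul_sub_pow_nonneg h₁ h 0 9, sub_pow_mul_sub_pow_nonneg h₁ h 1 8,
        sub_pow_mul_sub_pow_nonneg h₁ h 2 7, sub_pow_mul_sub_pow_nonneg h₁ h 3 6,
        sub_pow_mul_sub_pow_nonneg h₁ h 4 5, sub_pow_mul_sub_pow_nonneg h₁ h 5 4,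
        sub_pow_mul_sub_pow_nonneg h₁ h 6 3, sub_pow_mul_sub_pow_nonneg h₁ h 7 2,
        sub_pow_mul_sub_pow_nonneg h₁ h 8 1, sub_pow_mul_sub_pow_nonneg h₁ h 9 0]
  clear h₁
  rename' h => h₁
  rcases le_total t (1 / 50) with h | h
  · linarith [sub_pow_mul_sub_pow_nonneg h₁ h 0 9, sub_pow_mul_sub_pow_nonneg h₁ h 1 8,
        sub_pow_mul_sub_pow_nonneg h₁ h 2 7, sub_pow_mul_sub_pow_nonneg h₁ h 3 6,
        sub_pow_mul_sub_pow_nonneg h₁ h 4 5, sub_pow_mul_sub_pow_nonneg h₁ h 5 4,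
        sub_pow_mul_sub_pow_nonneg h₁ h 6 3, sub_pow_mul_sub_pow_nonneg h₁ h 7 2,
        sub_pow_mul_sub_pow_nonneg h₁ h 8 1, sub_pow_mul_sub_pow_nonneg h₁ h 9 0]
  clear h₁
  rename' h => h₁
  rcases le_total t (19 / 50) with h | h
  · linarith [sub_pow_mul_sub_pow_nonneg h₁ h 0 9, sub_pow_mul_sub_pow_nonneg h₁ h 1 8,
        sub_pow_mul_sub_pow_nonneg h₁ h 2 7, sub_pow_mul_sub_pow_nonneg h₁ h 3 6,
        sub_pow_mul_sub_pow_nonneg h₁ h 4 5, sub_pow_mul_sub_pow_nonneg h₁ h 5 4,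
        sub_pow_mul_sub_pow_nonneg h₁ h 6 3, sub_pow_mul_sub_pow_nonneg h₁ h 7 2,
        sub_pow_mul_sub_pow_nonneg h₁ h 8 1, sub_pow_mul_sub_pow_nonneg h₁ h 9 0]
  clear h₁
  rename' h => h₁
  linarith [sub_pow_mul_sub_pow_nonneg h₁ h₂ 0 9, sub_pow_mul_sub_pow_nonneg h₁ h₂ 1 8,
        sub_pow_mul_sub_pow_nonneg h₁ h₂ 2 7, sub_pow_mul_sub_pow_nonneg h₁ h₂ 3 6,
        sub_pow_mul_sub_pow_nonneg h₁ h₂ 4 5, sub_pow_mul_sub_pow_nonneg h₁ h₂ 5 4,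
        sub_pow_mul_sub_pow_nonneg h₁ h₂ 6 3, sub_pow_mul_sub_pow_nonneg h₁ h₂ 7 2,
        sub_pow_mul_sub_pow_nonneg h₁ h₂ 8 1, sub_pow_mul_sub_pow_nonneg h₁ h₂ 9 0]

theorem kissingPolynomial_neg_lt {t : ℝ} (h₁ : 70711 / 100000 ≤ t) (h₂ : t ≤ 1) :
    kissingPolynomial (-t) < 43 / 20 := by
  simp only [kissingPolynomial, legendreTwo, legendreThree, legendreFour, legendreFive, legendreNine]
  rcases le_total t (927 / 1000) with h | h
  · linarith [sub_pow_mul_sub_pow_nonneg h₁ h 0 9, sub_pow_mul_sub_pow_nonneg h₁ h 1 8,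
        sub_pow_mul_sub_pow_nonneg h₁ h 2 7, sub_pow_mul_sub_pow_nonneg h₁ h 3 6,
        sub_pow_mul_sub_pow_nonneg h₁ h 4 5, sub_pow_mul_sub_pow_nonneg h₁ h 5 4,
        sub_pow_mul_sub_pow_nonneg h₁ h 6 3, sub_pow_mul_sub_pow_nonneg h₁ h 7 2,
        sub_pow_mul_sub_pow_nonneg h₁ h 8 1, sub_pow_mul_sub_pow_nonneg h₁ h 9 0]
  clear h₁
  rename' h => h₁
  linarith [sub_pow_mul_sub_pow_nonneg h₁ h₂ 0 9, sub_pow_mul_sub_pow_nonneg h₁ h₂ 1 8,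
        sub_pow_mul_sub_pow_nonneg h₁ h₂ 2 7, sub_pow_mul_sub_pow_nonneg h₁ h₂ 3 6,
        sub_pow_mul_sub_pow_nonneg h₁ h₂ 4 5, sub_pow_mul_sub_pow_nonneg h₁ h₂ 5 4,
        sub_pow_mul_sub_pow_nonneg h₁ h₂ 6 3, sub_pow_mul_sub_pow_nonneg h₁ h₂ 7 2,
        sub_pow_mul_sub_pow_nonneg h₁ h₂ 8 1, sub_pow_mul_sub_pow_nonneg h₁ h₂ 9 0]

/-- The majorants from here on replace degree 9 by degree at most 2, so that sums over two or three
cap points can be bounded from the quadratic constraints that those points satisfy. -/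
theorem kissingPolynomial_neg_le_quadratic {t : ℝ} (h₁ : 39 / 50 ≤ t) (h₂ : t ≤ 233 / 250) :
    kissingPolynomial (-t) ≤ 3.894 - 16.66 * t + 15.464 * t ^ 2 := by
  simp only [kissingPolynomial, legendreTwo, legendreThree, legendreFour, legendreFive, legendreNine]
  rcases le_total t (447 / 500) with h | h
  · linarith [sub_pow_mul_sub_pow_nonneg h₁ h 0 9, sub_pow_mul_sub_pow_nonneg h₁ h 1 8,
        sub_pow_mul_sub_pow_nonneg h₁ h 2 7, sub_pow_mul_sub_pow_nonneg h₁ h 3 6,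
        sub_pow_mul_sub_pow_nonneg h₁ h 4 5, sub_pow_mul_sub_pow_nonneg h₁ h 5 4,
        sub_pow_mul_sub_pow_nonneg h₁ h 6 3, sub_pow_mul_sub_pow_nonneg h₁ h 7 2,
        sub_pow_mul_sub_pow_nonneg h₁ h 8 1, sub_pow_mul_sub_pow_nonneg h₁ h 9 0]
  clear h₁
  rename' h => h₁
  linarith [sub_pow_mul_sub_pow_nonneg h₁ h₂ 0 9, sub_pow_mul_sub_pow_nonneg h₁ h₂ 1 8,
        sub_pow_mul_sub_pow_nonneg h₁ h₂ 2 7, sub_pow_mul_sub_pow_nonneg h₁ h₂ 3 6,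
        sub_pow_mul_sub_pow_nonneg h₁ h₂ 4 5, sub_pow_mul_sub_pow_nonneg h₁ h₂ 5 4,
        sub_pow_mul_sub_pow_nonneg h₁ h₂ 6 3, sub_pow_mul_sub_pow_nonneg h₁ h₂ 7 2,
        sub_pow_mul_sub_pow_nonneg h₁ h₂ 8 1, sub_pow_mul_sub_pow_nonneg h₁ h₂ 9 0]

theorem kissingPolynomial_neg_le_quadratic' {t : ℝ} (h₁ : 70711 / 100000 ≤ t) (h₂ : t ≤ 483 / 500) :
    kissingPolynomial (-t) ≤ 4.92 - 18.22 * t + 15.95 * t ^ 2 := by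
  simp only [kissingPolynomial, legendreTwo, legendreThree, legendreFour, legendreFive, legendreNine]
  rcases le_total t (901 / 1000) with h | h
  · linarith [sub_pow_mul_sub_pow_nonneg h₁ h 0 9, sub_pow_mul_sub_pow_nonneg h₁ h 1 8,
        sub_pow_mul_sub_pow_nonneg h₁ h 2 7, sub_pow_mul_sub_pow_nonneg h₁ h 3 6,
        sub_pow_mul_sub_pow_nonneg h₁ h 4 5, sub_pow_mul_sub_pow_nonneg h₁ h 5 4,
        sub_pow_mul_sub_pow_nonneg h₁ h 6 3, sub_pow_mul_sub_pow_nonneg h₁ h 7 2,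
        sub_pow_mul_sub_pow_nonneg h₁ h 8 1, sub_pow_mul_sub_pow_nonneg h₁ h 9 0]
  clear h₁
  rename' h => h₁
  linarith [sub_pow_mul_sub_pow_nonneg h₁ h₂ 0 9, sub_pow_mul_sub_pow_nonneg h₁ h₂ 1 8,
        sub_pow_mul_sub_pow_nonneg h₁ h₂ 2 7, sub_pow_mul_sub_pow_nonneg h₁ h₂ 3 6,
        sub_pow_mul_sub_pow_nonneg h₁ h₂ 4 5, sub_pow_mul_sub_pow_nonneg h₁ h₂ 5 4,
        sub_pow_mul_sub_pow_nonneg h₁ h₂ 6 3, sub_pow_mul_sub_pow_nonneg h₁ h₂ 7 2,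
        sub_pow_mul_sub_pow_nonneg h₁ h₂ 8 1, sub_pow_mul_sub_pow_nonneg h₁ h₂ 9 0]

theorem kissingPolynomial_neg_le_linear {t : ℝ} (h₁ : 9 / 10 ≤ t) (h₂ : t ≤ 483 / 500) :
    kissingPolynomial (-t) ≤ -6.18 + 8.544 * t := by
  simp only [kissingPolynomial, legendreTwo, legendreThree, legendreFour, legendreFive, legendreNine]
  rcases le_total t (19 / 20) with h | h
  · linarith [sub_pow_mul_sub_pow_nonneg h₁ h 0 9, sub_pow_mul_sub_pow_nonneg h₁ h 1 8,
        sub_pow_mul_sub_pow_nonneg h₁ h 2 7, sub_pow_mul_sub_pow_nonneg h₁ h 3 6,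
        sub_pow_mul_sub_pow_nonneg h₁ h 4 5, sub_pow_mul_sub_pow_nonneg h₁ h 5 4,
        sub_pow_mul_sub_pow_nonneg h₁ h 6 3, sub_pow_mul_sub_pow_nonneg h₁ h 7 2,
        sub_pow_mul_sub_pow_nonneg h₁ h 8 1, sub_pow_mul_sub_pow_nonneg h₁ h 9 0]
  clear h₁
  rename' h => h₁
  linarith [sub_pow_mul_sub_pow_nonneg h₁ h₂ 0 9, sub_pow_mul_sub_pow_nonneg h₁ h₂ 1 8,
        sub_pow_mul_sub_pow_nonneg h₁ h₂ 2 7, sub_pow_mul_sub_pow_nonneg h₁ h₂ 3 6,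
        sub_pow_mul_sub_pow_nonneg h₁ h₂ 4 5, sub_pow_mul_sub_pow_nonneg h₁ h₂ 5 4,
        sub_pow_mul_sub_pow_nonneg h₁ h₂ 6 3, sub_pow_mul_sub_pow_nonneg h₁ h₂ 7 2,
        sub_pow_mul_sub_pow_nonneg h₁ h₂ 8 1, sub_pow_mul_sub_pow_nonneg h₁ h₂ 9 0]

theorem kissingPolynomial_neg_le_linear' {t : ℝ} (h₁ : 70711 / 100000 ≤ t) (h₂ : t ≤ 39 / 50) :
    kissingPolynomial (-t) ≤ -2.97 + 4.202 * t := by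
  simp only [kissingPolynomial, legendreTwo, legendreThree, legendreFour, legendreFive, legendreNine]
  linarith [sub_pow_mul_sub_pow_nonneg h₁ h₂ 0 9, sub_pow_mul_sub_pow_nonneg h₁ h₂ 1 8,
        sub_pow_mul_sub_pow_nonneg h₁ h₂ 2 7, sub_pow_mul_sub_pow_nonneg h₁ h₂ 3 6,
        sub_pow_mul_sub_pow_nonneg h₁ h₂ 4 5, sub_pow_mul_sub_pow_nonneg h₁ h₂ 5 4,
        sub_pow_mul_sub_pow_nonneg h₁ h₂ 6 3, sub_pow_mul_sub_pow_nonneg h₁ h₂ 7 2,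
        sub_pow_mul_sub_pow_nonneg h₁ h₂ 8 1, sub_pow_mul_sub_pow_nonneg h₁ h₂ 9 0]

theorem kissingPolynomial_neg_le {t : ℝ} (h₁ : 70711 / 100000 ≤ t) (h₂ : t ≤ 9 / 10) :
    kissingPolynomial (-t) ≤ 1.43 := by
  simp only [kissingPolynomial, legendreTwo, legendreThree, legendreFour, legendreFive, legendreNine]
  linarith [sub_pow_mul_sub_pow_nonneg h₁ h₂ 0 9, sub_pow_mul_sub_pow_nonneg h₁ h₂ 1 8,
        sub_pow_mul_sub_pow_nonneg h₁ h₂ 2 7, sub_pow_mul_sub_pow_nonneg h₁ h₂ 3 6,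
        sub_pow_mul_sub_pow_nonneg h₁ h₂ 4 5, sub_pow_mul_sub_pow_nonneg h₁ h₂ 5 4,
        sub_pow_mul_sub_pow_nonneg h₁ h₂ 6 3, sub_pow_mul_sub_pow_nonneg h₁ h₂ 7 2,
        sub_pow_mul_sub_pow_nonneg h₁ h₂ 8 1, sub_pow_mul_sub_pow_nonneg h₁ h₂ 9 0]

theorem kissingPolynomial_neg_le' {t : ℝ} (h₁ : 70711 / 100000 ≤ t) (h₂ : t ≤ 39 / 50) :
    kissingPolynomial (-t) ≤ 0.4 := by
  simp only [kissingPolynomial, legendreTwo, legendreThree, legendreFour, legendreFive, legendreNine]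
  linarith [sub_pow_mul_sub_pow_nonneg h₁ h₂ 0 9, sub_pow_mul_sub_pow_nonneg h₁ h₂ 1 8,
        sub_pow_mul_sub_pow_nonneg h₁ h₂ 2 7, sub_pow_mul_sub_pow_nonneg h₁ h₂ 3 6,
        sub_pow_mul_sub_pow_nonneg h₁ h₂ 4 5, sub_pow_mul_sub_pow_nonneg h₁ h₂ 5 4,
        sub_pow_mul_sub_pow_nonneg h₁ h₂ 6 3, sub_pow_mul_sub_pow_nonneg h₁ h₂ 7 2,
        sub_pow_mul_sub_pow_nonneg h₁ h₂ 8 1, sub_pow_mul_sub_pow_nonneg h₁ h₂ 9 0]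

/-- The constraint says that two points 60° apart have cosines `u`, `v` to the cap centre. If both
are at least 0.78, it gives u² + v² ≤ 1/2 + s²/3 with s = u + v ≤ √3; the quadratic majorants then
add up to a convex function of s that is small enough at both ends. Otherwise linear majorants
suffice. -/
theorem kissingPolynomial_neg_add_lt {u v : ℝ} (hu : 0.70711 ≤ u) (hv : 0.70711 ≤ v)
    (h : u ^ 2 + v ^ 2 - u * v ≤ 3 / 4) :
    kissingPolynomial (-u) + kissingPolynomial (-v) < 43 / 20 := by
  wlog huv : v ≤ u generalizing u v
  · have := this hv hu (by linarith) (le_of_not_ge huv)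
    linarith
  -- If one point is within 45° of the centre, the other is at least 15° away: cos 15° ≈ 0.9659.
  have hu' : u ≤ 0.966 := by nlinarith
  rcases le_total 0.78 v with hv' | hv'
  · have hu'' : u ≤ 0.932 := by nlinarith
    have h1 := kissingPolynomial_neg_le_quadratic (t := u) (by linarith) (by linarith)
    have h2 := kissingPolynomial_neg_le_quadratic (t := v) (by linarith) (by linarith)
    have hs : u + v ≤ 1.7321 := by nlinarith [sq_nonneg (u - v)]
    nlinarith [sq_nonneg (u - v)]
  · have h2 := kissingPolynomial_neg_le_linear' (t := v) (by linarith) (by linarith)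
    have h2' := kissingPolynomial_neg_le' (t := v) (by linarith) (by linarith)
    rcases le_total u 0.9 with hu'' | hu''
    · have h1 := kissingPolynomial_neg_le (t := u) (by linarith) (by linarith)
      linarith
    · have h1 := kissingPolynomial_neg_le_linear (t := u) (by linarith) (by linarith)
      -- (0.9462, 0.7533) is approximately where the sum of the two linear majorants is largest on
      -- the ellipse u² + v² - uv = 3/4.
      nlinarith [sq_nonneg (u - 0.9462), sq_nonneg (v - 0.7533),
        sq_nonneg ((u - 0.9462) - (v - 0.7533))]

theorem kissingPolynomial_neg_add_add_lt {u v w : ℝ} (hu : 0.70711 ≤ u) (hv : 0.70711 ≤ v)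
    (hw : 0.70711 ≤ w) (huv : u ^ 2 + v ^ 2 - u * v ≤ 3 / 4) (huw : u ^ 2 + w ^ 2 - u * w ≤ 3 / 4)
    (hs : (u + v + w) ^ 2 ≤ 6)
    (hq : u ^ 2 + v ^ 2 + w ^ 2 ≤ 1 / 2 + (u + v + w) ^ 2 / 4) :
    kissingPolynomial (-u) + kissingPolynomial (-v) + kissingPolynomial (-w) < 43 / 20 := by
  have hu' : u ≤ 0.966 := by nlinarith
  have hv' : v ≤ 0.966 := by nlinarith
  have hw' : w ≤ 0.966 := by nlinarith
  have h1 := kissingPolynomial_neg_le_quadratic' (t := u) (by linarith) (by linarith)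
  have h2 := kissingPolynomial_neg_le_quadratic' (t := v) (by linarith) (by linarith)
  have h3 := kissingPolynomial_neg_le_quadratic' (t := w) (by linarith) (by linarith)
  have hs' : u + v + w ≤ 2.4495 := by nlinarith
  have hs'' : 2.12 ≤ u + v + w := by linarith
  -- By `hq` the three majorants add up to at most a convex quadratic in s = u + v + w, which lies
  -- below its chord over [2.12, 2.4495]; the ends are just outside 3/√2 and √6.
  nlinarith [mul_nonneg (sub_nonneg.2 hs') (sub_nonneg.2 hs'')]

/-! ### Points in a cap around the antipode -/

section InnerProduct

variable {E : Type*} [NormedAddCommGroup E] [InnerProductSpace ℝ E]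

/-- Cauchy–Schwarz for `e` and (2u - v)x + (2v - u)y, which is parallel to the projection of `e` to
the span of x, y when the angle is exactly 60°. The weights are nonnegative because u and v lie in
[1/2, 1], so a smaller ⟪x, y⟫ only helps. With q = u² + v² - uv this reads 4q² ≤ 3q. -/
theorem sq_add_sq_sub_mul_le {e x y : E} (he : ‖e‖ = 1) (hx : ‖x‖ = 1) (hy : ‖y‖ = 1)
    (hxy : ⟪x, y⟫ ≤ 1 / 2) (hu : 1 / 2 ≤ ⟪e, x⟫) (hv : 1 / 2 ≤ ⟪e, y⟫) :
    ⟪e, x⟫ ^ 2 + ⟪e, y⟫ ^ 2 - ⟪e, x⟫ * ⟪e, y⟫ ≤ 3 / 4 := by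
  have hu' : ⟪e, x⟫ ≤ 1 := by simpa [he, hx] using real_inner_le_norm e x
  have hv' : ⟪e, y⟫ ≤ 1 := by simpa [he, hy] using real_inner_le_norm e y
  set u := ⟪e, x⟫
  set v := ⟪e, y⟫
  have hn : ∀ {y : E}, ‖y‖ = 1 → ⟪y, y⟫ = 1 := fun h => by
    rw [real_inner_self_eq_norm_sq, h, one_pow]
  have h := real_inner_mul_inner_self_le e ((2 * u - v) • x + (2 * v - u) • y)
  simp only [inner_add_left, inner_add_right, real_inner_smul_left, real_inner_smul_right,
    hn he, hn hx, hn hy, real_inner_comm x y] at h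
  have h2 : (2 * u - v) * (2 * v - u) * ⟪x, y⟫ ≤ (2 * u - v) * (2 * v - u) * (1 / 2) :=
    mul_le_mul_of_nonneg_left hxy (mul_nonneg (by linarith) (by linarith))
  have hq : 1 / 4 ≤ u ^ 2 + v ^ 2 - u * v := by nlinarith [sq_nonneg (u - v)]
  have h3 : (2 * (u ^ 2 + v ^ 2 - u * v)) * (2 * (u ^ 2 + v ^ 2 - u * v)) ≤
      3 * (u ^ 2 + v ^ 2 - u * v) := by
    rw [show ⟪e, x⟫ = u from rfl, show ⟪e, y⟫ = v from rfl] at h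
    linarith
  nlinarith

/-- Cauchy–Schwarz for `e` against nonnegative combinations of x, y, z. Equal weights bound the sum;
the second estimate uses the extremal weights for pairwise angles of 60°. -/
theorem three_unit_vectors_bound {e x y z : E} (he : ‖e‖ = 1) (hx : ‖x‖ = 1) (hy : ‖y‖ = 1)
    (hz : ‖z‖ = 1) (hxy : ⟪x, y⟫ ≤ 1 / 2) (hxz : ⟪x, z⟫ ≤ 1 / 2) (hyz : ⟪y, z⟫ ≤ 1 / 2)
    (hu : 0.7 ≤ ⟪e, x⟫) (hv : 0.7 ≤ ⟪e, y⟫) (hw : 0.7 ≤ ⟪e, z⟫) :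
    (⟪e, x⟫ + ⟪e, y⟫ + ⟪e, z⟫) ^ 2 ≤ 6 ∧
      ⟪e, x⟫ ^ 2 + ⟪e, y⟫ ^ 2 + ⟪e, z⟫ ^ 2 ≤ 1 / 2 + (⟪e, x⟫ + ⟪e, y⟫ + ⟪e, z⟫) ^ 2 / 4 := by
  have key : ∀ a b c : ℝ, 0 ≤ a → 0 ≤ b → 0 ≤ c →
      (a * ⟪e, x⟫ + b * ⟪e, y⟫ + c * ⟪e, z⟫) ^ 2 ≤
        a ^ 2 + b ^ 2 + c ^ 2 + a * b + a * c + b * c := by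
    intro a b c ha hb hc
    have hn : ∀ {y : E}, ‖y‖ = 1 → ⟪y, y⟫ = 1 := fun h => by
      rw [real_inner_self_eq_norm_sq, h, one_pow]
    have h := real_inner_mul_inner_self_le e (a • x + b • y + c • z)
    simp only [inner_add_left, inner_add_right, real_inner_smul_left, real_inner_smul_right,
      hn he, hn hx, hn hy, hn hz, real_inner_comm x y, real_inner_comm x z,
      real_inner_comm y z] at h
    have h1 := mul_le_mul_of_nonneg_left hxy (mul_nonneg ha hb)
    have h2 := mul_le_mul_of_nonneg_left hxz (mul_nonneg ha hc)
    have h3 := mul_le_mul_of_nonneg_left hyz (mul_nonneg hb hc)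
    linarith
  set u := ⟪e, x⟫
  set v := ⟪e, y⟫
  set w := ⟪e, z⟫
  have hs : (u + v + w) ^ 2 ≤ 6 := by
    have := key 1 1 1 zero_le_one zero_le_one zero_le_one
    linarith
  have hs' : u + v + w ≤ 2.5 := by nlinarith
  refine ⟨hs, ?_⟩
  -- The weights apply 2I - J/2, the inverse of the Gram matrix (I + J)/2 (J the all-ones matrix),
  -- to (u, v, w). They are nonnegative since 2 · 0.7 exceeds 2.5 / 2. The result has the form T² ≤
  -- T, hence T ≤ 1.
  have h := key (2 * u - (u + v + w) / 2) (2 * v - (u + v + w) / 2) (2 * w - (u + v + w) / 2)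
    (by linarith) (by linarith) (by linarith)
  have h' : (2 * (u ^ 2 + v ^ 2 + w ^ 2) - (u + v + w) ^ 2 / 2) ^ 2 ≤
      2 * (u ^ 2 + v ^ 2 + w ^ 2) - (u + v + w) ^ 2 / 2 := by
    linarith
  nlinarith

end InnerProduct

theorem inner_fin_three (x y : EuclideanSpace ℝ (Fin 3)) :
    ⟪x, y⟫ = x 0 * y 0 + x 1 * y 1 + x 2 * y 2 := by
  simp only [PiLp.inner_apply, Fin.sum_univ_three, RCLike.inner_apply, conj_trivial]
  ring

/-- The projections of four vectors to the plane orthogonal to `e` cannot pairwise make obtuse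
angles. -/
theorem not_four_obtuse {e a b c d : EuclideanSpace ℝ (Fin 3)} (he : ‖e‖ = 1) (ha : ‖a‖ = 1)
    (hab : ⟪a, b⟫ < ⟪e, a⟫ * ⟪e, b⟫) (hac : ⟪a, c⟫ < ⟪e, a⟫ * ⟪e, c⟫)
    (had : ⟪a, d⟫ < ⟪e, a⟫ * ⟪e, d⟫) (hbc : ⟪b, c⟫ < ⟪e, b⟫ * ⟪e, c⟫)
    (hbd : ⟪b, d⟫ < ⟪e, b⟫ * ⟪e, d⟫) (hcd : ⟪c, d⟫ < ⟪e, c⟫ * ⟪e, d⟫) : False := by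
  have hea : ⟪e, a⟫ ^ 2 ≤ 1 := by
    have := real_inner_mul_inner_self_le e a
    rw [real_inner_self_eq_norm_sq, real_inner_self_eq_norm_sq, he, ha] at this
    linarith
  -- D y = det(e, a, y), and the product of two such determinants is the determinant of the matrix
  -- of mutual inner products.
  obtain ⟨D, hD⟩ : ∃ D : EuclideanSpace ℝ (Fin 3) → ℝ, ∀ y z, D y * D z =
      ⟪e, e⟫ * (⟪a, a⟫ * ⟪y, z⟫ - ⟪a, z⟫ * ⟪a, y⟫) -
        ⟪e, a⟫ * (⟪e, a⟫ * ⟪y, z⟫ - ⟪a, z⟫ * ⟪e, y⟫) +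
        ⟪e, z⟫ * (⟪e, a⟫ * ⟪a, y⟫ - ⟪a, a⟫ * ⟪e, y⟫) := by
    refine ⟨fun y => e 0 * (a 1 * y 2 - a 2 * y 1) - e 1 * (a 0 * y 2 - a 2 * y 0) +
      e 2 * (a 0 * y 1 - a 1 * y 0), fun y z => ?_⟩
    simp only [inner_fin_three]
    ring
  -- With primes for projections orthogonal to `e`, D y * D z = |a'|²⟪y', z'⟫ - ⟪a', y'⟫⟪a', z'⟫.
  -- Thus b', c', d' would lie pairwise on opposite sides of the line through a', which three
  -- vectors cannot do.
  have hneg : ∀ y z : EuclideanSpace ℝ (Fin 3), ⟪a, y⟫ < ⟪e, a⟫ * ⟪e, y⟫ →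
      ⟪a, z⟫ < ⟪e, a⟫ * ⟪e, z⟫ → ⟪y, z⟫ < ⟪e, y⟫ * ⟪e, z⟫ → D y * D z < 0 := by
    intro y z hy hz hyz
    have h1 := hD y z
    rw [real_inner_self_eq_norm_sq, real_inner_self_eq_norm_sq, he, ha] at h1
    have h2 := mul_pos (sub_pos.2 hy) (sub_pos.2 hz)
    have h3 := mul_nonneg (sub_nonneg.2 hea) (sub_pos.2 hyz).le
    linarith
  have h1 := hneg b c hab hac hbc
  have h2 := hneg b d hab had hbd
  have h3 := hneg c d hac had hcd
  have h4 := mul_pos_of_neg_of_neg h1 h2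
  have h5 := mul_nonneg (mul_self_nonneg (D b)) (neg_nonneg.2 h3.le)
  linarith

/-! ### The kissing number of three-dimensional space -/

theorem sum_kissingPolynomial_lt {ι : Type*} [Fintype ι] {x : ι → EuclideanSpace ℝ (Fin 3)}
    (hx : ∀ i, ‖x i‖ = 1) (hxx : ∀ i j, i ≠ j → ⟪x i, x j⟫ ≤ 1 / 2) (i : ι) :
    ∑ j, kissingPolynomial ⟪x i, x j⟫ < 13 := by
  classical
  -- The cutoff is just above 1/√2: the product of two such cosines exceeds 1/2, which makes the
  -- projections of cap points pairwise obtuse and limits their number to three.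
  let J : Finset ι := Finset.univ.filter fun j => 0.70711 < ⟪-x i, x j⟫
  have hJ : ∀ {j}, j ∈ J → 0.70711 < ⟪-x i, x j⟫ := fun h => (Finset.mem_filter.1 h).2
  have he : ‖-x i‖ = 1 := by rw [norm_neg, hx]
  have hii : ⟪x i, x i⟫ = 1 := by rw [real_inner_self_eq_norm_sq, hx, one_pow]
  have hle : ∑ j, kissingPolynomial ⟪x i, x j⟫ ≤
      217 / 20 + ∑ j ∈ J, kissingPolynomial (-⟪-x i, x j⟫) := by
    have h : ∀ j ∈ Finset.univ, kissingPolynomial ⟪x i, x j⟫ ≤ (if i = j then 217 / 20 else 0) +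
        (if j ∈ J then kissingPolynomial (-⟪-x i, x j⟫) else 0) := by
      intro j _
      by_cases hij : i = j
      · subst hij
        have : i ∉ J := fun h => by
          have := hJ h
          rw [inner_neg_left, hii] at this
          norm_num at this
        rw [if_pos rfl, if_neg this, hii, kissingPolynomial_one, add_zero]
      · rw [if_neg hij, zero_add]
        by_cases hj : j ∈ J
        · rw [if_pos hj, inner_neg_left, neg_neg]
        · rw [if_neg hj]
          have h1 : ¬ 0.70711 < ⟪-x i, x j⟫ := fun h =>
            hj (Finset.mem_filter.2 ⟨Finset.mem_univ _, h⟩)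
          rw [inner_neg_left] at h1
          exact kissingPolynomial_nonpos (by norm_num at h1 ⊢; linarith) (hxx i j hij)
    refine (Finset.sum_le_sum h).trans_eq ?_
    rw [Finset.sum_add_distrib, Finset.sum_ite_eq, if_pos (Finset.mem_univ _),
      Finset.sum_ite_mem, Finset.univ_inter]
  refine hle.trans_lt ?_
  -- 43/20 is 13 minus the diagonal value 217/20.
  suffices h : ∑ j ∈ J, kissingPolynomial (-⟪-x i, x j⟫) < 43 / 20 by linarith
  have hpair : ∀ {a b}, a ∈ J → b ∈ J → a ≠ b →
      ⟪-x i, x a⟫ ^ 2 + ⟪-x i, x b⟫ ^ 2 - ⟪-x i, x a⟫ * ⟪-x i, x b⟫ ≤ 3 / 4 := fun ha hb hab =>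
    sq_add_sq_sub_mul_le he (hx _) (hx _) (hxx _ _ hab)
      (by have := hJ ha; norm_num at this ⊢; linarith)
      (by have := hJ hb; norm_num at this ⊢; linarith)
  have hcard : J.card ≤ 3 := by
    by_contra! hc
    obtain ⟨K, hKJ, hK⟩ := Finset.exists_subset_card_eq (s := J) (n := 4) hc
    obtain ⟨a, L, haL, rfl, hL⟩ := Finset.card_eq_succ.1 hK
    obtain ⟨b, c, d, hbc, hbd, hcd, rfl⟩ := Finset.card_eq_three.1 hL
    simp only [Finset.mem_insert, Finset.mem_singleton, not_or] at haL
    have hob : ∀ {a b}, a ∈ J → b ∈ J → a ≠ b → ⟪x a, x b⟫ < ⟪-x i, x a⟫ * ⟪-x i, x b⟫ := by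
      intro a b ha hb hab
      have h1 := hJ ha
      have h2 := hJ hb
      have h3 := hxx a b hab
      nlinarith
    have ha : a ∈ J := hKJ (by simp)
    have hb : b ∈ J := hKJ (by simp)
    have hc : c ∈ J := hKJ (by simp)
    have hd : d ∈ J := hKJ (by simp)
    exact not_four_obtuse he (hx a) (hob ha hb haL.1) (hob ha hc haL.2.1) (hob ha hd haL.2.2)
      (hob hb hc hbc) (hob hb hd hbd) (hob hc hd hcd)
  rcases J.card.eq_zero_or_pos with h0 | hpos
  · rw [Finset.card_eq_zero.1 h0, Finset.sum_empty]
    norm_num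
  have h123 : J.card = 1 ∨ J.card = 2 ∨ J.card = 3 := by omega
  rcases h123 with h | h | h
  · obtain ⟨a, ha⟩ := Finset.card_eq_one.1 h
    rw [ha, Finset.sum_singleton]
    have haJ : a ∈ J := by simp [ha]
    refine kissingPolynomial_neg_lt (by have := hJ haJ; norm_num at this ⊢; linarith) ?_
    simpa [he, hx] using real_inner_le_norm (-x i) (x a)
  · obtain ⟨a, b, hab, hJe⟩ := Finset.card_eq_two.1 h
    have ha : a ∈ J := by simp [hJe]
    have hb : b ∈ J := by simp [hJe]
    rw [hJe, Finset.sum_pair hab]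
    exact kissingPolynomial_neg_add_lt (hJ ha).le (hJ hb).le (hpair ha hb hab)
  · obtain ⟨a, b, c, hab, hac, hbc, hJe⟩ := Finset.card_eq_three.1 h
    have ha : a ∈ J := by simp [hJe]
    have hb : b ∈ J := by simp [hJe]
    have hc : c ∈ J := by simp [hJe]
    have hJ' : ∀ {j}, j ∈ J → 0.7 ≤ ⟪-x i, x j⟫ := fun hj => by
      have := hJ hj
      norm_num at this ⊢
      linarith
    obtain ⟨hs, hq⟩ := three_unit_vectors_bound he (hx a) (hx b) (hx c) (hxx _ _ hab)
      (hxx _ _ hac) (hxx _ _ hbc) (hJ' ha) (hJ' hb) (hJ' hc)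
    rw [hJe, Finset.sum_insert (by simp [hab, hac]), Finset.sum_pair hbc, ← add_assoc]
    exact kissingPolynomial_neg_add_add_lt (hJ ha).le (hJ hb).le (hJ hc).le (hpair ha hb hab)
      (hpair ha hc hac) hs hq

/-- The kissing number of the three-dimensional space is at most twelve. -/
theorem card_le_twelve {ι : Type*} [Fintype ι] {x : ι → EuclideanSpace ℝ (Fin 3)}
    (hx : ∀ i, ‖x i‖ = 1) (hxx : ∀ i j, i ≠ j → ⟪x i, x j⟫ ≤ 1 / 2) : Fintype.card ι ≤ 12 := by
  let u : ι → ℝ := fun i => x i 2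
  let z : ι → ℂ := fun i => ⟨x i 0, x i 1⟩
  have hz : ∀ i, Complex.normSq (z i) = 1 - u i ^ 2 := by
    intro i
    have h := inner_fin_three (x i) (x i)
    rw [real_inner_self_eq_norm_sq, hx] at h
    rw [Complex.normSq_mk]
    simp only [u]
    linarith
  have hi : ∀ i j, u i * u j + (z i * conj (z j)).re = ⟪x i, x j⟫ := by
    intro i j
    rw [inner_fin_three, Complex.mul_re, Complex.conj_re, Complex.conj_im]
    simp only [u, z]
    ring
  -- Subtracting 1 removes the constant Legendre term, which alone contributes n² to the double sum.
  have hsum : IsPosSum fun i j => kissingPolynomial ⟪x i, x j⟫ - 1 := by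
    have h := (((((isPosSum_inner u z).const_mul
      (by norm_num : (0 : ℝ) ≤ 191 / 100)).add
      ((isPosSum_legendreTwo hz).const_mul
      (by norm_num : (0 : ℝ) ≤ 7 / 2))).add
      ((isPosSum_legendreThree hz).const_mul
      (by norm_num : (0 : ℝ) ≤ 39 / 20))).add
      ((isPosSum_legendreFour hz).const_mul
      (by norm_num : (0 : ℝ) ≤ 199 / 100))).add
      ((isPosSum_legendreFive hz).const_mul (by norm_num : (0 : ℝ) ≤ 3 / 25)) |>.add
      ((isPosSum_legendreNine hz).const_mul
      (by norm_num : (0 : ℝ) ≤ 19 / 50))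
    simp only [hi] at h
    convert h using 3
    rw [kissingPolynomial]
    ring
  unfold IsPosSum at hsum
  simp only [Finset.sum_sub_distrib, Finset.sum_const, Finset.card_univ, nsmul_eq_mul,
    mul_one] at hsum
  by_contra! hn
  have hne : (Finset.univ : Finset ι).Nonempty := by
    rw [← Finset.card_pos, Finset.card_univ]
    omega
  have hlt := Finset.sum_lt_sum_of_nonempty hne fun i _ => sum_kissingPolynomial_lt hx hxx i
  rw [Finset.sum_const, Finset.card_univ, nsmul_eq_mul] at hlt
  have hn' : (13 : ℝ) ≤ Fintype.card ι := by exact_mod_cast hn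
  nlinarith

/-! ### At most six low points -/

/-- An even trigonometric polynomial in `t = cos φ` with nonnegative coefficients. -/
noncomputable def circlePolynomial (t : ℝ) : ℝ :=
  1 + 43 / 20 * t + 77 / 40 * (2 * t ^ 2 - 1) + 127 / 100 * (4 * t ^ 3 - 3 * t) +
    49 / 100 * (8 * t ^ 4 - 8 * t ^ 2 + 1)

theorem circlePolynomial_nonpos {t : ℝ} (h₁ : -1 ≤ t) (h₂ : t ≤ 0.57736) :
    circlePolynomial t ≤ 0 := by
  have hb : ∀ {a b : ℝ}, a ≤ t → t ≤ b → 0 ≤ (t - a) ^ 4 ∧ 0 ≤ (t - a) ^ 3 * (b - t) ∧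
      0 ≤ (t - a) ^ 2 * (b - t) ^ 2 ∧ 0 ≤ (t - a) * (b - t) ^ 3 ∧ 0 ≤ (b - t) ^ 4 := by
    intro a b ha hb
    have h := fun i j => sub_pow_mul_sub_pow_nonneg ha hb i j
    have h' := (h 4 0).trans_eq (by ring : _ = (t - a) ^ 4)
    have h'' := (h 0 4).trans_eq (by ring : _ = (b - t) ^ 4)
    exact ⟨h', (h 3 1).trans_eq (by ring), h 2 2, (h 1 3).trans_eq (by ring), h''⟩
  unfold circlePolynomial
  rcases le_total t (-0.501) with h | h
  · obtain ⟨_, _, _, _, _⟩ := hb h₁ h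
    linarith
  rcases le_total t (-0.357) with h' | h'
  · obtain ⟨_, _, _, _, _⟩ := hb h h'
    linarith
  · obtain ⟨_, _, _, _, _⟩ := hb h' h₂
    linarith

/-- At most six points of the unit circle have pairwise angles at least `arccos (1 / √3)`. -/
theorem card_le_six_of_circle {ι : Type*} [Fintype ι] {z : ι → ℂ}
    (hz : ∀ i, Complex.normSq (z i) = 1)
    (hzz : ∀ i j, i ≠ j → (z i * conj (z j)).re ≤ 0.57736) : Fintype.card ι ≤ 6 := by
  classical
  have hsum : IsPosSum fun i j => circlePolynomial (z i * conj (z j)).re - 1 := by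
    have h := ((((isPosSum_azimuthal (fun _ => 1) z 1).const_mul
        (by norm_num : (0 : ℝ) ≤ 43 / 20)).add
      ((isPosSum_azimuthal (fun _ => 1) z 2).const_mul
      (by norm_num : (0 : ℝ) ≤ 77 / 40))).add
      ((isPosSum_azimuthal (fun _ => 1) z 3).const_mul
      (by norm_num : (0 : ℝ) ≤ 127 / 100))).add
      ((isPosSum_azimuthal (fun _ => 1) z 4).const_mul
      (by norm_num : (0 : ℝ) ≤ 49 / 100))
    convert h using 3
    simp only [azimuthal_zero, azimuthal_one, azimuthal_add_two, zero_add, Nat.reduceAdd, hz,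
      circlePolynomial]
    ring
  unfold IsPosSum at hsum
  simp only [Finset.sum_sub_distrib, Finset.sum_const, Finset.card_univ, nsmul_eq_mul,
    mul_one] at hsum
  -- Off-diagonal terms are nonpositive and the value at 1 is 6.835, so n² ≤ 6.9n. This is
  -- Delsarte's method on the circle, and no cyclic ordering of the points is needed.
  have hlt : ∀ i ∈ Finset.univ, ∑ j, circlePolynomial (z i * conj (z j)).re ≤ 6.9 := by
    intro i _
    have h : ∀ j ∈ Finset.univ,
        circlePolynomial (z i * conj (z j)).re ≤ if i = j then 6.9 else 0 := by
      intro j _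
      by_cases hij : i = j
      · rw [if_pos hij, ← hij, Complex.mul_conj, hz]
        norm_num [circlePolynomial]
      · rw [if_neg hij]
        refine circlePolynomial_nonpos ?_ (hzz i j hij)
        have h := Complex.abs_re_le_norm (z i * conj (z j))
        have hn : ‖z i * conj (z j)‖ ^ 2 = 1 := by
          rw [← Complex.normSq_eq_norm_sq, Complex.normSq_mul, Complex.normSq_conj, hz, hz, one_mul]
        rw [(pow_eq_one_iff_of_nonneg (norm_nonneg _) two_ne_zero).1 hn] at h
        exact (abs_le.1 h).1
    refine (Finset.sum_le_sum h).trans_eq ?_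
    rw [Finset.sum_ite_eq, if_pos (Finset.mem_univ _)]
  have hle := Finset.sum_le_sum hlt
  rw [Finset.sum_const, Finset.card_univ, nsmul_eq_mul] at hle
  by_contra! hn
  have hn' : (7 : ℝ) ≤ Fintype.card ι := by exact_mod_cast hn
  nlinarith

/-- The cosine of the azimuth difference is at most (1/2 - uv)/√((1 - u²)(1 - v²)) for heights u, v
in [0, 1/2]. Its maximum is 1/√3, at heights 0 and 1/2; 0.57736 is a rational just above it. -/
theorem card_le_six_of_low {ι : Type*} [Fintype ι] {x : ι → EuclideanSpace ℝ (Fin 3)}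
    (hx : ∀ i, ‖x i‖ = 1) (h0 : ∀ i, 0 ≤ x i 2) (h1 : ∀ i, x i 2 ≤ 1 / 2)
    (hxx : ∀ i j, i ≠ j → ⟪x i, x j⟫ ≤ 1 / 2) : Fintype.card ι ≤ 6 := by
  have hsq : ∀ i, x i 0 * x i 0 + x i 1 * x i 1 = 1 - x i 2 ^ 2 := by
    intro i
    have h := inner_fin_three (x i) (x i)
    rw [real_inner_self_eq_norm_sq, hx] at h
    linarith
  have hpos : ∀ i, 0 < 1 - x i 2 ^ 2 := fun i => by nlinarith [h0 i, h1 i]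
  let r : ι → ℝ := fun i => Real.sqrt (1 - x i 2 ^ 2)
  have hr : ∀ i, 0 < r i := fun i => Real.sqrt_pos.2 (hpos i)
  have hr2 : ∀ i, r i ^ 2 = 1 - x i 2 ^ 2 := fun i => Real.sq_sqrt (hpos i).le
  refine card_le_six_of_circle (z := fun i => ⟨x i 0 / r i, x i 1 / r i⟩) (fun i => ?_)
    fun i j hij => ?_
  · have := (hr i).ne'
    rw [Complex.normSq_mk, div_mul_div_comm, div_mul_div_comm, ← add_div, hsq, ← hr2, sq,
      div_self (mul_ne_zero this this)]
  · have h := hxx i j hij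
    rw [inner_fin_three] at h
    have hrr : 0 < r i * r j := mul_pos (hr i) (hr j)
    have hu0 := h0 i
    have hv0 := h0 j
    have hu1 := h1 i
    have hv1 := h1 j
    have hre : ((⟨x i 0 / r i, x i 1 / r i⟩ : ℂ) * conj (⟨x j 0 / r j, x j 1 / r j⟩ : ℂ)).re =
        (x i 0 * x j 0 + x i 1 * x j 1) / (r i * r j) := by
      rw [Complex.mul_re, Complex.conj_re, Complex.conj_im, mul_neg, sub_neg_eq_add,
        div_mul_div_comm, div_mul_div_comm, add_div]
    rw [hre, div_le_iff₀ hrr]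
    have hsq' : (r i * r j) ^ 2 = (1 - x i 2 ^ 2) * (1 - x j 2 ^ 2) := by
      rw [mul_pow, hr2, hr2]
    generalize x i 2 = u at *
    generalize x j 2 = v at *
    have h2 : 3 * (1 / 2 - u * v) ^ 2 ≤ (r i * r j) ^ 2 := by
      rw [hsq']
      -- The claim is u² + v² + 2u²v² - 3uv ≤ 1/4, whose left side is convex in each variable. Here
      -- u² is replaced by its chord u/2 on [0, 1/2].
      have h3 : 2 * u ^ 2 * v ^ 2 + u ^ 2 ≤ u / 2 * (2 * v ^ 2 + 1) := by
        nlinarith [mul_nonneg (mul_nonneg hu0 (sub_nonneg.2 hu1))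
          (by positivity : 0 ≤ 2 * v ^ 2 + 1)]
      nlinarith [mul_nonneg hu0 (mul_nonneg hv0 (sub_nonneg.2 hv1)),
        mul_nonneg (sub_nonneg.2 hu1) (mul_nonneg hv0 (sub_nonneg.2 hv1)),
        mul_nonneg (sub_nonneg.2 hu1) (mul_nonneg (sub_nonneg.2 hv1) (by linarith : 0 ≤ 1 / 2 + v))]
    have h4 : 1 / 2 - u * v ≤ 0.57736 * (r i * r j) := by
      refine le_of_sq_le_sq ?_ (by positivity)
      nlinarith
    linarith

/-! ### Doubling the high points -/

/-- Reflection in the equatorial plane. -/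
noncomputable def equatorReflection (x : EuclideanSpace ℝ (Fin 3)) : EuclideanSpace ℝ (Fin 3) :=
  !₂[x 0, x 1, -x 2]

theorem inner_equatorReflection_right (x y : EuclideanSpace ℝ (Fin 3)) :
    ⟪x, equatorReflection y⟫ = ⟪x, y⟫ - 2 * (x 2 * y 2) := by
  simp only [inner_fin_three, equatorReflection]
  simp
  ring

theorem inner_equatorReflection (x y : EuclideanSpace ℝ (Fin 3)) :
    ⟪equatorReflection x, equatorReflection y⟫ = ⟪x, y⟫ := by
  simp [inner_fin_three, equatorReflection]

theorem norm_equatorReflection (x : EuclideanSpace ℝ (Fin 3)) : ‖equatorReflection x‖ = ‖x‖ := by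
  have h := inner_equatorReflection x x
  rw [real_inner_self_eq_norm_sq, real_inner_self_eq_norm_sq] at h
  exact (sq_eq_sq₀ (norm_nonneg _) (norm_nonneg _)).1 h

/-- Adding the mirror images of the points above the height `1 / 2` gives a kissing
configuration. -/
theorem card_add_card_high_le {P : Finset (EuclideanSpace ℝ (Fin 3))} (h1 : ∀ p ∈ P, ‖p‖ = 1)
    (h0 : ∀ p ∈ P, 0 ≤ p 2) (hP : ∀ p ∈ P, ∀ q ∈ P, p ≠ q → ⟪p, q⟫ ≤ 1 / 2) :
    P.card + (P.filter fun p => 1 / 2 < p 2).card ≤ 12 := by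
  let Q := P.filter fun p => 1 / 2 < p 2
  have hQ : ∀ {q}, q ∈ Q → q ∈ P ∧ 1 / 2 < q 2 := fun h => Finset.mem_filter.1 h
  -- Reflecting `q` lowers the inner product by twice the product of the heights; for p = q it
  -- becomes 1 - 2q₃², which is below 1/2 as q₃ > 1/2.
  have hcross : ∀ p ∈ P, ∀ q ∈ Q, ⟪p, equatorReflection q⟫ ≤ 1 / 2 := by
    intro p hp q hq
    obtain ⟨hq, hq'⟩ := hQ hq
    rw [inner_equatorReflection_right]
    by_cases hpq : p = q
    · rw [hpq, real_inner_self_eq_norm_sq, h1 q hq]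
      nlinarith
    · linarith [hP p hp q hq hpq, mul_nonneg (h0 p hp) (h0 q hq)]
  have h := card_le_twelve (ι := P ⊕ Q)
    (x := Sum.elim (fun p => p.1) fun q => equatorReflection q.1) ?_ ?_
  · simpa only [Fintype.card_sum, Fintype.card_coe] using h
  · rintro (p | q)
    · exact h1 p p.2
    · exact (norm_equatorReflection _).trans (h1 q (hQ q.2).1)
  · rintro (p | p) (q | q) hpq
    · exact hP p p.2 q q.2 fun h => hpq (congrArg Sum.inl (Subtype.ext h))
    · exact hcross p p.2 q q.2
    · exact (real_inner_comm _ _).trans_le (hcross q q.2 p p.2)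
    · simp only [Sum.elim_inr, inner_equatorReflection]
      exact hP p (hQ p.2).1 q (hQ q.2).1 fun h => hpq (congrArg Sum.inr (Subtype.ext h))

theorem card_low_le {P : Finset (EuclideanSpace ℝ (Fin 3))} (h1 : ∀ p ∈ P, ‖p‖ = 1)
    (h0 : ∀ p ∈ P, 0 ≤ p 2) (hP : ∀ p ∈ P, ∀ q ∈ P, p ≠ q → ⟪p, q⟫ ≤ 1 / 2) :
    (P.filter fun p => ¬ 1 / 2 < p 2).card ≤ 6 := by
  let Q := P.filter fun p => ¬ 1 / 2 < p 2
  have hQ : ∀ {q}, q ∈ Q → q ∈ P ∧ ¬ 1 / 2 < q 2 := fun h => Finset.mem_filter.1 h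
  have h := card_le_six_of_low (ι := Q) (x := fun p => p.1) (fun p => h1 _ (hQ p.2).1)
    (fun p => h0 _ (hQ p.2).1) (fun p => not_lt.1 (hQ p.2).2)
    fun p q hpq => hP _ (hQ p.2).1 _ (hQ q.2).1 fun h => hpq (Subtype.ext h)
  simpa only [Fintype.card_coe] using h

/-! ### From angles to inner products and heights -/

section Angle

variable {E : Type*} [NormedAddCommGroup E] [InnerProductSpace ℝ E]

theorem cos_angle_of_unit {x y : E} (hx : ‖x‖ = 1) (hy : ‖y‖ = 1) :
    Real.cos (InnerProductGeometry.angle x y) = ⟪x, y⟫ := by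
  rw [InnerProductGeometry.cos_angle, hx, hy, mul_one, div_one]

theorem angle_mem_Icc (x y : E) : InnerProductGeometry.angle x y ∈ Set.Icc 0 Real.pi :=
  ⟨InnerProductGeometry.angle_nonneg x y, InnerProductGeometry.angle_le_pi x y⟩

theorem pi_div_three_le_angle_iff {x y : E} (hx : ‖x‖ = 1) (hy : ‖y‖ = 1) :
    Real.pi / 3 ≤ InnerProductGeometry.angle x y ↔ ⟪x, y⟫ ≤ 1 / 2 := by
  have hpi := Real.pi_pos
  rw [← Real.strictAntiOn_cos.le_iff_ge (angle_mem_Icc x y) ⟨by linarith, by linarith⟩,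
    cos_angle_of_unit hx hy, Real.cos_pi_div_three]

theorem angle_le_pi_div_two_iff {x y : E} (hx : ‖x‖ = 1) (hy : ‖y‖ = 1) :
    InnerProductGeometry.angle x y ≤ Real.pi / 2 ↔ 0 ≤ ⟪x, y⟫ := by
  have hpi := Real.pi_pos
  rw [← Real.strictAntiOn_cos.le_iff_ge ⟨by linarith, by linarith⟩ (angle_mem_Icc x y),
    cos_angle_of_unit hx hy, Real.cos_pi_div_two]

end Angle

theorem inner_northPole (x : EuclideanSpace ℝ (Fin 3)) : ⟪x, northPole 3⟫ = x 2 := by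
  rw [northPole, EuclideanSpace.inner_single_right]
  simp
  rfl

theorem norm_northPole : ‖northPole 3‖ = 1 := by
  simp [northPole]

theorem mem_upperHemisphere_iff (p : EuclideanSpace ℝ (Fin 3)) :
    p ∈ upperHemisphere 3 ↔ ‖p‖ = 1 ∧ 0 ≤ p 2 := by
  rw [upperHemisphere, Set.mem_ofPred_eq, mem_sphere_zero_iff_norm]
  rfl

theorem isOneSidedKissingArrangement_iff (P : Set (EuclideanSpace ℝ (Fin 3))) :
    IsOneSidedKissingArrangement P ↔ (∀ p ∈ P, ‖p‖ = 1) ∧ (∀ p ∈ P, 0 ≤ p 2) ∧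
      ∀ p ∈ P, ∀ q ∈ P, p ≠ q → ⟪p, q⟫ ≤ 1 / 2 := by
  constructor
  · rintro ⟨hP, hPP⟩
    have h := fun p hp => (mem_upperHemisphere_iff p).1 (hP hp)
    exact ⟨fun p hp => (h p hp).1, fun p hp => (h p hp).2, fun p hp q hq hpq =>
      (pi_div_three_le_angle_iff (h p hp).1 (h q hq).1).1 (hPP hp hq hpq)⟩
  · rintro ⟨h1, h0, hP⟩
    exact ⟨fun p hp => (mem_upperHemisphere_iff p).2 ⟨h1 p hp, h0 p hp⟩, fun p hp q hq hpq =>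
      (pi_div_three_le_angle_iff (h1 p hp) (h1 q hq)).2 (hP p hp q hq hpq)⟩

/-! ### The bound nine and the case of equality -/

theorem card_le_nine {P : Finset (EuclideanSpace ℝ (Fin 3))}
    (hP : IsOneSidedKissingArrangement (P : Set (EuclideanSpace ℝ (Fin 3)))) : P.card ≤ 9 := by
  obtain ⟨h1, h0, h⟩ := (isOneSidedKissingArrangement_iff _).1 hP
  have ha := card_low_le h1 h0 h
  have hb := card_add_card_high_le h1 h0 h
  have hab := P.card_filter_add_card_filter_not fun p => 1 / 2 < p 2
  omega

theorem IsOneSidedKissingArrangement.encard_le {P : Set (EuclideanSpace ℝ (Fin 3))}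
    (hP : IsOneSidedKissingArrangement P) : P.encard ≤ 9 := by
  by_contra! h
  -- Passing to a ten-point subset also covers infinite `P`.
  have h' : ((10 : ℕ) : ℕ∞) ≤ P.encard := by
    have := Order.add_one_le_of_lt h
    norm_num at this ⊢
    exact this
  obtain ⟨T, hTP, hT⟩ := Set.exists_subset_encard_eq h'
  have hfin : T.Finite := Set.finite_of_encard_eq_coe hT
  have hT' : IsOneSidedKissingArrangement (hfin.toFinset : Set (EuclideanSpace ℝ (Fin 3))) := by
    rw [hfin.coe_toFinset]
    exact ⟨hTP.trans hP.1, hP.2.mono hTP⟩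
  have hcard := card_le_nine hT'
  rw [hfin.encard_eq_coe_toFinset_card, Nat.cast_inj] at hT
  omega

/-- With a + b = 9, the bound a + 2b ≤ 12 gives b ≤ 3, and a ≤ 6 gives b ≥ 3. -/
theorem encard_lowPart_highPart {P : Set (EuclideanSpace ℝ (Fin 3))}
    (hP : IsOneSidedKissingArrangement P) (hcard : P.encard = 9) :
    (lowPart P).encard = 6 ∧ (highPart P).encard = 3 := by
  have hfin : P.Finite := Set.finite_of_encard_eq_coe (k := 9) hcard
  obtain ⟨P, rfl⟩ := hfin.exists_finset_coe
  obtain ⟨h1, h0, h⟩ := (isOneSidedKissingArrangement_iff _).1 hP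
  have ha := card_low_le h1 h0 h
  have hb := card_add_card_high_le h1 h0 h
  have hab := P.card_filter_add_card_filter_not fun p => 1 / 2 < p 2
  have hn : P.card = 9 := by
    rw [Set.encard_coe_eq_coe_finsetCard] at hcard
    exact_mod_cast hcard
  have hlow : lowPart (P : Set (EuclideanSpace ℝ (Fin 3))) =
      (P.filter fun p => ¬ 1 / 2 < p 2 : Finset _) := by
    ext p
    simp only [lowPart, Set.mem_ofPred_eq, Finset.coe_filter, Finset.mem_coe, not_lt]
    refine and_congr_right fun hp => ?_
    rw [pi_div_three_le_angle_iff (h1 p hp) norm_northPole,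
      angle_le_pi_div_two_iff (h1 p hp) norm_northPole, inner_northPole]
    exact and_iff_left (h0 p hp)
  have hhigh : highPart (P : Set (EuclideanSpace ℝ (Fin 3))) =
      (P.filter fun p => 1 / 2 < p 2 : Finset _) := by
    ext p
    simp only [highPart, Set.mem_ofPred_eq, Finset.coe_filter, Finset.mem_coe]
    refine and_congr_right fun hp => ?_
    rw [← not_le, pi_div_three_le_angle_iff (h1 p hp) norm_northPole, inner_northPole, not_le]
  rw [hlow, hhigh, Set.encard_coe_eq_coe_finsetCard, Set.encard_coe_eq_coe_finsetCard]
  have e1 : (P.filter fun p => ¬ 1 / 2 < p 2).card = 6 := by omega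
  have e2 : (P.filter fun p => 1 / 2 < p 2).card = 3 := by omega
  rw [e1, e2]
  exact ⟨rfl, rfl⟩

/-! ### An arrangement of nine points -/

/-- Six points of the equator and three points at the height `√6 / 3`. -/
noncomputable def optimalPoint (i : Fin 9) : EuclideanSpace ℝ (Fin 3) :=
  !₂[((![6, 3, -3, -6, -3, 3, 3, -3, 0] : Fin 9 → ℤ) i : ℝ) / 6,
    ((![0, 3, 3, 0, -3, -3, 1, 1, -2] : Fin 9 → ℤ) i : ℝ) * Real.sqrt 3 / 6,
    ((![0, 0, 0, 0, 0, 0, 2, 2, 2] : Fin 9 → ℤ) i : ℝ) * Real.sqrt 6 / 6]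

/-- Each coordinate carries a fixed radical, so all inner products are integers over 36 and the
required checks become finite computations over ℤ. -/
theorem inner_optimalPoint (i j : Fin 9) : ⟪optimalPoint i, optimalPoint j⟫ =
    (((![6, 3, -3, -6, -3, 3, 3, -3, 0] : Fin 9 → ℤ) i *
        (![6, 3, -3, -6, -3, 3, 3, -3, 0] : Fin 9 → ℤ) j +
      3 * (![0, 3, 3, 0, -3, -3, 1, 1, -2] : Fin 9 → ℤ) i *
        (![0, 3, 3, 0, -3, -3, 1, 1, -2] : Fin 9 → ℤ) j +
      6 * (![0, 0, 0, 0, 0, 0, 2, 2, 2] : Fin 9 → ℤ) i *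
        (![0, 0, 0, 0, 0, 0, 2, 2, 2] : Fin 9 → ℤ) j : ℤ) : ℝ) / 36 := by
  have h3 : Real.sqrt 3 ^ 2 = 3 := Real.sq_sqrt (by norm_num)
  have h6 : Real.sqrt 6 ^ 2 = 6 := Real.sq_sqrt (by norm_num)
  generalize hX : (![6, 3, -3, -6, -3, 3, 3, -3, 0] : Fin 9 → ℤ) = X
  generalize hY : (![0, 3, 3, 0, -3, -3, 1, 1, -2] : Fin 9 → ℤ) = Y
  generalize hZ : (![0, 0, 0, 0, 0, 0, 2, 2, 2] : Fin 9 → ℤ) = Z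
  have hc : ∀ k, optimalPoint k 0 = X k / 6 ∧ optimalPoint k 1 = Y k * Real.sqrt 3 / 6 ∧
      optimalPoint k 2 = Z k * Real.sqrt 6 / 6 := fun k => by
    rw [← hX, ← hY, ← hZ]
    exact ⟨rfl, rfl, rfl⟩
  rw [inner_fin_three, (hc i).1, (hc i).2.1, (hc i).2.2, (hc j).1, (hc j).2.1, (hc j).2.2]
  push_cast
  linear_combination (Y i * Y j / 36 : ℝ) * h3 + (Z i * Z j / 36 : ℝ) * h6

theorem norm_optimalPoint (i : Fin 9) : ‖optimalPoint i‖ = 1 := by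
  have h := inner_optimalPoint i i
  rw [real_inner_self_eq_norm_sq] at h
  refine (pow_eq_one_iff_of_nonneg (norm_nonneg _) two_ne_zero).1 (h.trans ?_)
  rw [div_eq_one_iff_eq (by norm_num)]
  norm_cast
  clear h
  revert i
  decide

theorem inner_optimalPoint_le {i j : Fin 9} (hij : i ≠ j) :
    ⟪optimalPoint i, optimalPoint j⟫ ≤ 1 / 2 := by
  rw [inner_optimalPoint, div_le_iff₀ (by norm_num), show (1 / 2 * 36 : ℝ) = (18 : ℤ) by norm_num,
    Int.cast_le]
  revert i j
  decide

theorem isOneSidedKissingArrangement_range_optimalPoint :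
    IsOneSidedKissingArrangement (Set.range optimalPoint) := by
  rw [isOneSidedKissingArrangement_iff]
  refine ⟨?_, ?_, ?_⟩
  · rintro _ ⟨i, rfl⟩
    exact norm_optimalPoint i
  · rintro _ ⟨i, rfl⟩
    have h : 0 ≤ (![0, 0, 0, 0, 0, 0, 2, 2, 2] : Fin 9 → ℤ) i := by
      revert i
      decide
    have h' : (0 : ℝ) ≤ ((![0, 0, 0, 0, 0, 0, 2, 2, 2] : Fin 9 → ℤ) i : ℝ) := Int.cast_nonneg h
    exact div_nonneg (mul_nonneg h' (Real.sqrt_nonneg 6)) (by norm_num)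
  · rintro _ ⟨i, rfl⟩ _ ⟨j, rfl⟩ hij
    exact inner_optimalPoint_le fun h => hij (congrArg _ h)

theorem encard_range_optimalPoint : (Set.range optimalPoint).encard = 9 := by
  have hinj : Function.Injective optimalPoint := by
    intro i j hij
    by_contra hne
    have h := inner_optimalPoint_le hne
    rw [hij, real_inner_self_eq_norm_sq, norm_optimalPoint] at h
    norm_num at h
  rw [← Set.image_univ, hinj.encard_image, Set.encard_univ, ENat.card_eq_coe_fintype_card,
    Fintype.card_fin]
  rfl

theorem oneSidedCodeNumber_three : oneSidedCodeNumber 3 = 9 := by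
  refine le_antisymm (iSup₂_le fun P hP => hP.encard_le) ?_
  rw [← encard_range_optimalPoint]
  exact le_iSup₂_of_le _ isOneSidedKissingArrangement_range_optimalPoint le_rfl

/-! ### Touching spheres and points of the hemisphere -/

section Configuration

variable {n : ℕ}

theorem nonoverlapping_iff {x y : EuclideanSpace ℝ (Fin n)} :
    Nonoverlapping x y ↔ 2 ≤ dist x y := by
  rw [Nonoverlapping, disjoint_ball_ball_iff one_pos one_pos]
  norm_num

theorem sphere_subset_closedHalfSpace_iff {ν x : EuclideanSpace ℝ (Fin n)} {c : ℝ}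
    (hν : ‖ν‖ = 1) : Metric.sphere x 1 ⊆ closedHalfSpace ν c ↔ c + 1 ≤ ⟪ν, x⟫ := by
  constructor
  · intro h
    have hx : x - ν ∈ Metric.sphere x 1 := by simp [hν]
    have h' : c ≤ ⟪ν, x - ν⟫ := h hx
    rw [inner_sub_right, real_inner_self_eq_norm_sq, hν] at h'
    linarith
  · intro h y hy
    have h1 := real_inner_le_norm ν (x - y)
    rw [hν, ← dist_eq_norm, dist_comm, mem_sphere_iff_norm.1 hy |> (dist_eq_norm y x).trans,
      inner_sub_right] at h1
    change c ≤ ⟪ν, y⟫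
    linarith

theorem IsOneSidedKissingConfiguration.dist_eq {ν z : EuclideanSpace ℝ (Fin n)} {c : ℝ}
    {C : Set (EuclideanSpace ℝ (Fin n))} (h : IsOneSidedKissingConfiguration ν c z C)
    {x : EuclideanSpace ℝ (Fin n)} (hx : x ∈ C) : ‖x - z‖ = 2 := by
  obtain ⟨h1, y, hyx, hyz⟩ := h.touches x hx
  rw [← dist_eq_norm]
  refine le_antisymm ?_ (nonoverlapping_iff.1 h1)
  have := dist_triangle_left x z y
  rw [Metric.mem_sphere.1 hyx, Metric.mem_sphere.1 hyz] at this
  linarith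

/-- The central sphere touches the hyperplane, so its centre has height at most `c + 1`, while every
other centre has height at least `c + 1`. -/
theorem IsOneSidedKissingConfiguration.inner_nonneg {ν z : EuclideanSpace ℝ (Fin n)} {c : ℝ}
    {C : Set (EuclideanSpace ℝ (Fin n))} (h : IsOneSidedKissingConfiguration ν c z C)
    {x : EuclideanSpace ℝ (Fin n)} (hx : x ∈ C) : 0 ≤ ⟪ν, x - z⟫ := by
  obtain ⟨y, hyz, hy⟩ := h.central_touches
  have h1 := (sphere_subset_closedHalfSpace_iff h.norm_normal).1 (h.subset x hx)
  have h2 := real_inner_le_norm ν (z - y)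
  rw [h.norm_normal, ← dist_eq_norm, dist_comm, Metric.mem_sphere.1 hyz, inner_sub_right,
    show ⟪ν, y⟫ = c from hy] at h2
  rw [inner_sub_right]
  linarith

theorem IsOneSidedKissingConfiguration.inner_le {ν z : EuclideanSpace ℝ (Fin n)} {c : ℝ}
    {C : Set (EuclideanSpace ℝ (Fin n))} (h : IsOneSidedKissingConfiguration ν c z C)
    {x y : EuclideanSpace ℝ (Fin n)} (hx : x ∈ C) (hy : y ∈ C) (hxy : x ≠ y) :
    ⟪x - z, y - z⟫ ≤ 2 := by
  have h1 := nonoverlapping_iff.1 (h.pairwise_nonoverlapping hx hy hxy)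
  have h2 := norm_sub_sq_real (x - z) (y - z)
  rw [sub_sub_sub_cancel_right, h.dist_eq hx, h.dist_eq hy, ← dist_eq_norm] at h2
  nlinarith

end Configuration

/-- Translating `z` to the origin, reflecting `ν` to the north pole and halving turns the centres
into a one-sided kissing arrangement of the same size. -/
theorem IsOneSidedKissingConfiguration.encard_le {ν z : EuclideanSpace ℝ (Fin 3)} {c : ℝ}
    {C : Set (EuclideanSpace ℝ (Fin 3))} (h : IsOneSidedKissingConfiguration ν c z C) :
    C.encard ≤ 9 := by
  obtain ⟨ρ, hρ⟩ : ∃ ρ : EuclideanSpace ℝ (Fin 3) ≃ₗᵢ[ℝ] EuclideanSpace ℝ (Fin 3),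
      ρ ν = northPole 3 :=
    ⟨_, Submodule.reflection_sub (h.norm_normal.trans norm_northPole.symm)⟩
  let f : EuclideanSpace ℝ (Fin 3) → EuclideanSpace ℝ (Fin 3) := fun x => (1 / 2 : ℝ) • ρ (x - z)
  have hinner : ∀ x y, ⟪f x, f y⟫ = ⟪x - z, y - z⟫ / 4 := fun x y => by
    simp only [f, real_inner_smul_left, real_inner_smul_right, LinearIsometryEquiv.inner_map_map]
    ring
  have hf : Function.Injective f := fun x y hxy =>
    sub_left_injective (ρ.injective (smul_right_injective _ (by norm_num) hxy))
  rw [← hf.encard_image]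
  refine IsOneSidedKissingArrangement.encard_le ((isOneSidedKissingArrangement_iff _).2
    ⟨?_, ?_, ?_⟩)
  · rintro _ ⟨x, hx, rfl⟩
    simp only [f, norm_smul, LinearIsometryEquiv.norm_map, h.dist_eq hx]
    norm_num
  · rintro _ ⟨x, hx, rfl⟩
    rw [← inner_northPole, ← hρ, real_inner_smul_left, LinearIsometryEquiv.inner_map_map,
      real_inner_comm]
    linarith [h.inner_nonneg hx]
  · rintro _ ⟨x, hx, rfl⟩ _ ⟨y, hy, rfl⟩ hxy
    rw [hinner]
    linarith [h.inner_le hx hy fun hxy' => hxy (congrArg f hxy')]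

/-- Conversely, doubling the points gives centres at distance 2 from the origin; the sphere around
2p touches the central one at p, and the hyperplane is the tangent plane at the south pole. -/
theorem IsOneSidedKissingArrangement.isOneSidedKissingConfiguration
    {P : Set (EuclideanSpace ℝ (Fin 3))} (hP : IsOneSidedKissingArrangement P) :
    IsOneSidedKissingConfiguration (northPole 3) (-1) 0
      ((fun x : EuclideanSpace ℝ (Fin 3) => (2 : ℝ) • x) '' P) := by
  obtain ⟨h1, h0, h⟩ := (isOneSidedKissingArrangement_iff _).1 hP
  refine ⟨norm_northPole, ?_, ⟨-northPole 3, ?_, ?_⟩, ?_, ?_, ?_⟩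
  · rw [sphere_subset_closedHalfSpace_iff norm_northPole, inner_zero_right]
    norm_num
  · simp [norm_northPole]
  · change ⟪northPole 3, -northPole 3⟫ = -1
    rw [inner_neg_right, real_inner_self_eq_norm_sq, norm_northPole, one_pow]
  · rintro _ ⟨p, hp, rfl⟩
    rw [sphere_subset_closedHalfSpace_iff norm_northPole, real_inner_smul_right, real_inner_comm,
      inner_northPole]
    linarith [h0 p hp]
  · rintro _ ⟨p, hp, rfl⟩
    refine ⟨?_, p, ?_, ?_⟩
    · rw [nonoverlapping_iff, dist_zero_right, norm_smul, h1 p hp]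
      norm_num
    · change p ∈ Metric.sphere ((2 : ℝ) • p) 1
      rw [mem_sphere_iff_norm, two_smul, sub_add_cancel_left, norm_neg, h1 p hp]
    · rw [mem_sphere_zero_iff_norm, h1 p hp]
  · rintro _ ⟨p, hp, rfl⟩ _ ⟨q, hq, rfl⟩ hpq
    have hpq' := h p hp q hq fun h => hpq (congrArg _ h)
    have h2 := norm_sub_sq_real p q
    rw [h1 p hp, h1 q hq] at h2
    rw [nonoverlapping_iff, dist_eq_norm, ← smul_sub, norm_smul, Real.norm_ofNat]
    have h3 : 1 ≤ ‖p - q‖ := by nlinarith [norm_nonneg (p - q)]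
    linarith

theorem oneSidedKissingNumber_three : oneSidedKissingNumber 3 = 9 := by
  refine le_antisymm (iSup_le fun ν => iSup_le fun c => iSup_le fun z => iSup₂_le fun C hC =>
    hC.encard_le) ?_
  have h := isOneSidedKissingArrangement_range_optimalPoint.isOneSidedKissingConfiguration
  refine le_trans ?_
    (le_iSup_of_le _ (le_iSup_of_le _ (le_iSup_of_le _ (le_iSup₂_of_le _ h le_rfl))))
  rw [(smul_right_injective _ two_ne_zero).encard_image, encard_range_optimalPoint]

theorem corollary1 :
    oneSidedKissingNumber 3 = 9 ∧
    oneSidedCodeNumber 3 = 9 ∧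
    ∀ P : Set (EuclideanSpace ℝ (Fin 3)), IsOneSidedKissingArrangement P →
      P.encard = oneSidedKissingNumber 3 →
        (lowPart P).encard = 6 ∧ (highPart P).encard = 3 :=
  ⟨oneSidedKissingNumber_three, oneSidedCodeNumber_three, fun _ hP hcard =>
    encard_lowPart_highPart hP (hcard.trans oneSidedKissingNumber_three)⟩
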